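/- Polynomial run-time of (quantum) random Fourier features. Setting. A kernel on $\mathbb R^d$ is a symmetric, positive semi-definite function $k:\mathbb R^d\times\mathbb R^d\to\mathbb R$; it is shift-invariant if $k(x+\xi,x'+\xi)=k(x,x')$ for all $x,x',\xi$, and then one writes $k(x,x')=k(x-x')$. Its inverse Fourier transform is the probability measure $p$ on $\mathbb R^d$ with $k(\Delta)=\int e^{i\langle\omega,\Delta\rangle}\,dp(\omega)$ for all $\Delta$. For even $D$, RFF draws $\omega_1,\dots,\omega_{D/2}$ i.i.d. from $p$ and returns the feature map $$z(x)=\sqrt{2/D}\,\bigl(\cos\langle\omega_1,x\rangle,\sin\langle\omega_1,x\rangle,\dots,\cos\langle\omega_{D/2},x\rangle,\sin\langle\omega_{D/2},x\rangle\bigr).$$ QRFF calls RFF and returns the quantum feature map $\rho(x)=\rho_{z(x)/g(x)}$, where $g(x)=\|z(x)\|_1$. Here, for $r\in\mathbb R^D$ with $\|r\|_1=1$, $\rho_r$ is the state on $n=\lceil\log_4(D+1)\rceil$ qubits that is obtained by padding $r$ with zeros to length $4^n-1$ and preparing $2^{-n}(\mathbb I+\operatorname{sign}(r_i)P_i)$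 with probability $|r_i|$, where $P_1,\dots,P_{4^n-1}$ are the non-identity Pauli operators on $n$ qubits. Run-time is counted on a real-number random access machine (unit-cost arithmetic and comparison of reals, $\sqrt{\cdot}$, $\cos$, $\sin$, uniform random numbers in $[0,1]$; addition, truncated subtraction, halving and comparison of natural numbers) that can allocate qubits in state $|0\rangle$ and apply $X,H,S,T$ and CNOT gates to them at unit cost, and that can call a subroutine drawing a sample from $p$ at cost $t(d)$, plus $d+O(1)$ for storing it. The total run-time of RFF is the time to construct $z$ (from $d$ and $D/2$) plus the time to evaluate it at a point $x$; that of QRFF is the time to construct $z$ plus the time to prepare $\rho(x)$ and compute $g(x)$, for a point $x$. Statement. There are fixed programs implementing RFF and QRFF exactly, each using exactly $D/2$ samples, with the following property. For every $\delta\in(0,1)$ there is a constant $C>0$ depending only on $\delta$ such that, with $$D=2\left\lceil C\,\frac{d}{\varepsilon^2}\Bigl(1+\log^+\frac{Rd\sqrt B}{\varepsilon}\Bigr)\right\rceil ,\qquad \log^+ y=\max(0,\log y)\ \ (\log^+0=0),$$ the following holds for all real $R,B\ge0$ and all $t:\mathbb N\to\mathbb N$ that are bounded by a polynomial in $d$ for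 $d\ge1$. (1) There is a polynomial $P$, depending only on $\delta,R,B,t$, such that for all $d\ge1$ and $\varepsilon>0$ the total run-times of RFF and QRFF are at most $P(d+\lceil1/\varepsilon\rceil)$ for every outcome of the random choices and every $x\in\mathbb R^d$; in particular they are polynomial in $d$ for fixed $\varepsilon$. (2) Let $d\ge1$ and $\varepsilon>0$, let $\mathcal X_d\subseteq[-R,R]^d$ be compact, and let $k_d$ be a continuous shift-invariant kernel on $\mathbb R^d$ with $k_d(0)=1$ whose second partial derivatives $\partial_i^2k_d(0)$ exist and satisfy $|\partial_i^2k_d(0)|\le B$ for all $i$. Let $p_d$ be the inverse Fourier transform of $k_d$, and let the samples be drawn i.i.d. from $p_d$. Then, with probability at least $1-\delta$, $$|\langle z(x),z(x')\rangle-k_d(x-x')|<\varepsilon\quad\text{for all }x,x'\in\mathcal X_d ;$$ each $\rho(x)$ is a density operator; and, with probability at least $1-\delta$, $$\bigl|g(x)g(x')\bigl(2^n\operatorname{Tr}\{\rho(x)\rho(x')\}-1\bigr)-k_d(x-x')\bigr|<\varepsilon\quad\text{for all }x,x'\in\mathcal X_d .$$ -/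

import Mathlib

open MeasureTheory ProbabilityTheory Filter Topology
open scoped ComplexOrder

noncomputable section

namespace QRFF

/-- The data space `ℝ^d` with its Euclidean inner product. -/
abbrev E (d : ℕ) : Type := EuclideanSpace ℝ (Fin d)

/-! ## Kernels -/

/-- A (real) kernel function on `𝒳`: symmetric and positive semi-definite. -/
structure IsKernel {𝒳 : Type*} (k : 𝒳 → 𝒳 → ℝ) : Prop where
  symm : ∀ x x', k x x' = k x' x
  psd : ∀ (N : ℕ) (x : Fin N → 𝒳) (a : Fin N → ℝ), 0 ≤ ∑ i, ∑ j, a i * a j * k (x i) (x j)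

/-- `k (x + ξ) (x' + ξ) = k x x'`. One then writes `k Δ` for `k Δ 0`, where `Δ = x - x'`. -/
def IsShiftInvariant {d : ℕ} (k : E d → E d → ℝ) : Prop :=
  ∀ x x' ξ, k (x + ξ) (x' + ξ) = k x x'

/-- For every coordinate `i`, the second partial derivative `∂ᵢ² k` of `Δ ↦ k Δ 0` exists at the
origin and has absolute value at most `B`. -/
def SecondPartialsBounded {d : ℕ} (k : E d → E d → ℝ) (B : ℝ) : Prop :=
  ∀ i : Fin d,
    (∀ᶠ s in 𝓝 (0 : ℝ), DifferentiableAt ℝ (fun r : ℝ => k (EuclideanSpace.single i r) 0) s) ∧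
    DifferentiableAt ℝ (deriv fun r : ℝ => k (EuclideanSpace.single i r) 0) 0 ∧
    |deriv (deriv fun r : ℝ => k (EuclideanSpace.single i r) 0) 0| ≤ B

/-- Continuous shift-invariant kernels on `ℝ^d` with `k(0) = 1` whose second derivatives at the
origin are bounded by `B`. -/
structure IsSmoothShiftInvariantKernel {d : ℕ} (k : E d → E d → ℝ) (B : ℝ) : Prop where
  kernel : IsKernel k
  shift : IsShiftInvariant k
  cont : Continuous fun Δ : E d => k Δ 0
  one : k 0 0 = 1
  smooth : SecondPartialsBounded k B

/-- The measure `p` is the inverse Fourier transform of the shift-invariant kernel `k`: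
`k(Δ) = ∫ exp(i⟨ω, Δ⟩) dp(ω)` for all `Δ`. -/
def IsInverseFT {d : ℕ} (p : Measure (E d)) (k : E d → E d → ℝ) : Prop :=
  ∀ Δ : E d, charFun p Δ = (k Δ 0 : ℂ)

/-! ## The feature map of random Fourier features -/

/-- The feature map `z` of RFF in dimension `D = 2 m`, built from the frequencies
`ω 0, …, ω (m - 1)`: entries `2j` and `2j + 1` are `√(2/D) cos⟨ω j, x⟩`, `√(2/D) sin⟨ω j, x⟩`. -/
def rffMap {d : ℕ} (m : ℕ) (ω : ℕ → E d) (x : E d) (i : Fin (2 * m)) : ℝ :=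
  √(2 / ((2 * m : ℕ) : ℝ)) *
    (if (i : ℕ) % 2 = 0 then Real.cos (inner ℝ (ω ((i : ℕ) / 2)) x)
      else Real.sin (inner ℝ (ω ((i : ℕ) / 2)) x))

/-- The `1`-norm of a real vector. -/
def norm1 {D : ℕ} (r : Fin D → ℝ) : ℝ := ∑ i, |r i|

/-! ## Quantum states and the classical-to-quantum embedding -/

/-- Operators on `n` qubits; the computational basis is indexed by bit strings. -/
abbrev QOp (n : ℕ) : Type := Matrix (Fin n → Fin 2) (Fin n → Fin 2) ℂ

/-- `I, X, Y, Z`. -/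
def pauli : Fin 4 → Matrix (Fin 2) (Fin 2) ℂ :=
  ![1, !![0, 1; 1, 0], !![0, -Complex.I; Complex.I, 0], !![1, 0; 0, -1]]

/-- The `i`-th Pauli operator on `n` qubits (`0 ≤ i < 4 ^ n`, with `i = 0` the identity): the tensor
product over the qubits `j` of the Pauli matrices named by the base-4 digits of `i`. -/
def pauliOp (n i : ℕ) : QOp n :=
  Matrix.of fun b c => ∏ j : Fin n, pauli (Fin.ofNat 4 (i / 4 ^ (j : ℕ))) (b j) (c j)

/-- `n = ⌈log₄ (D + 1)⌉`. -/
def numQubits (D : ℕ) : ℕ := Nat.clog 4 (D + 1)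

/-- The vector `r = (r₁, …, r_D)` padded with zeros (1-based indices). -/
def padded {D : ℕ} (r : Fin D → ℝ) (i : ℕ) : ℝ :=
  if h : 1 ≤ i ∧ i ≤ D then r ⟨i - 1, by omega⟩ else 0

/-- The mixed state output by the classical-to-quantum embedding: with probability `|rᵢ|` the state
`(1 + sign(rᵢ) Pᵢ) / 2ⁿ`, for `1 ≤ i ≤ 4ⁿ - 1`. -/
def c2qe {D : ℕ} (r : Fin D → ℝ) : QOp (numQubits D) :=
  ∑ i ∈ Finset.Icc 1 (4 ^ numQubits D - 1),
    ((|padded r i| : ℝ) : ℂ) • (((2 : ℂ) ^ numQubits D)⁻¹ •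
      ((1 : QOp (numQubits D)) + ((Real.sign (padded r i) : ℝ) : ℂ) • pauliOp (numQubits D) i))

/-- `g(x) = ‖z(x)‖₁`. -/
def rffNorm {d : ℕ} (m : ℕ) (ω : ℕ → E d) (x : E d) : ℝ := norm1 (rffMap m ω x)

/-- The quantum feature map of QRFF: the embedding of the `1`-normalized vector `z(x)`. -/
def qrffState {d : ℕ} (m : ℕ) (ω : ℕ → E d) (x : E d) : QOp (numQubits (2 * m)) :=
  c2qe fun i => rffMap m ω x i / rffNorm m ω x

/-- The embedding quantum kernel of a data embedding `ρ`. -/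
def eqk {𝒳 : Type*} {n : ℕ} (ρ : 𝒳 → QOp n) (x x' : 𝒳) : ℂ := Matrix.trace (ρ x * ρ x')

/-- Density operators. -/
def IsDensity {n : ℕ} (ρ : QOp n) : Prop := ρ.PosSemidef ∧ ρ.trace = 1

/-! ## Quantum circuits -/

/-- Elementary gates acting on numbered qubits. -/
inductive Gate : Type
  | X (j : ℕ)
  | H (j : ℕ)
  | S (j : ℕ)
  | T (j : ℕ)
  | CNOT (control target : ℕ)

/-- Action of a one-qubit matrix on qubit `j` of an `n`-qubit state vector. -/
def applyOne {n : ℕ} (U : Matrix (Fin 2) (Fin 2) ℂ) (j : ℕ) (ψ : (Fin n → Fin 2) → ℂ) :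
    (Fin n → Fin 2) → ℂ :=
  if h : j < n then
    fun b => ∑ c : Fin 2, U (b ⟨j, h⟩) c * ψ (Function.update b ⟨j, h⟩ c)
  else ψ

/-- Action of a gate on an `n`-qubit state vector (trivial if it names a qubit that does not exist
or if control and target of a CNOT coincide). -/
def Gate.apply {n : ℕ} : Gate → ((Fin n → Fin 2) → ℂ) → ((Fin n → Fin 2) → ℂ)
  | .X j, ψ => applyOne !![0, 1; 1, 0] j ψ
  | .H j, ψ => applyOne ((((√2)⁻¹ : ℝ) : ℂ) • !![1, 1; 1, -1]) j ψ
  | .S j, ψ => applyOne !![1, 0; 0, Complex.I] j ψ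
  | .T j, ψ => applyOne !![1, 0; 0, Complex.exp (Complex.I * Real.pi / 4)] j ψ
  | .CNOT i j, ψ =>
      if h : i < n ∧ j < n ∧ i ≠ j then
        fun b => ψ (Function.update b ⟨j, h.2.1⟩ (b ⟨j, h.2.1⟩ + b ⟨i, h.1⟩))
      else ψ

/-- The state vector obtained from `|0…0⟩` by a list of gates (first gate applied first). -/
def circuitState (n : ℕ) (gates : List Gate) : (Fin n → Fin 2) → ℂ :=
  gates.foldl (fun ψ G => G.apply ψ) fun b => if b = 0 then 1 else 0

/-! ## The machine

A real-number random access machine that controls a quantum register. Classical memory: registers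
holding natural numbers and arrays of real numbers. Programs are finite and mention no problem
instance; every evaluated expression costs its number of symbols and every executed instruction
costs at least one unit. A program can call a subroutine that draws a sample from a
distribution on `ℝ^d`, at cost `t` (plus `d` for storing the sample), and can draw a uniform random
number from `[0, 1]`. -/

/-- Natural-number expressions: registers, constants, sum, truncated difference, halving. -/
inductive NExp : Type
  | reg (r : ℕ)
  | const (c : ℕ)
  | add (e f : NExp)
  | sub (e f : NExp)
  | half (e : NExp)

/-- Real expressions over array entries. -/
inductive RExp : Type
  | mem (a : ℕ) (e : NExp)
  | const (c : ℚ)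
  | cast (e : NExp)
  | add (e f : RExp)
  | sub (e f : RExp)
  | mul (e f : RExp)
  | div (e f : RExp)
  | sqrt (e : RExp)
  | cos (e : RExp)
  | sin (e : RExp)

/-- Tests. -/
inductive Test : Type
  | nle (e f : NExp)
  | rle (e f : RExp)

/-- Programs. -/
inductive Prog : Type
  | skip
  | setReg (r : ℕ) (e : NExp)
  | setMem (a : ℕ) (i : NExp) (e : RExp)
  | seq (c c' : Prog)
  | ite (b : Test) (c c' : Prog)
  | loop (e : NExp) (c : Prog)
  | sample (a : ℕ) (i : NExp)
  | rand (a : ℕ) (i : NExp)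
  | newQubit
  | gateX (i : NExp)
  | gateH (i : NExp)
  | gateS (i : NExp)
  | gateT (i : NExp)
  | gateCNOT (i j : NExp)

/-- Machine states: registers, real arrays, numbers of samples and of uniform random numbers drawn
so far, number of qubits allocated, gates applied so far, time spent so far. -/
structure State : Type where
  reg : ℕ → ℕ
  mem : ℕ → ℕ → ℝ
  nsamp : ℕ
  nrand : ℕ
  nqubit : ℕ
  gates : List Gate
  time : ℕ

/-- What a run depends on apart from program and input: the dimension `d`, the cost `t` of a sample,
the sequence `ω` of samples, and the sequence `u` of uniform random numbers. -/
structure Env (d : ℕ) : Type where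
  t : ℕ
  ω : ℕ → E d
  u : ℕ → unitInterval

def NExp.eval (s : State) : NExp → ℕ
  | .reg r => s.reg r
  | .const c => c
  | .add e f => e.eval s + f.eval s
  | .sub e f => e.eval s - f.eval s
  | .half e => e.eval s / 2

def NExp.size : NExp → ℕ
  | .reg _ => 1
  | .const _ => 1
  | .add e f => e.size + f.size + 1
  | .sub e f => e.size + f.size + 1
  | .half e => e.size + 1

def RExp.eval (s : State) : RExp → ℝ
  | .mem a e => s.mem a (e.eval s)
  | .const c => (c : ℝ)
  | .cast e => ((e.eval s : ℕ) : ℝ)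
  | .add e f => e.eval s + f.eval s
  | .sub e f => e.eval s - f.eval s
  | .mul e f => e.eval s * f.eval s
  | .div e f => e.eval s / f.eval s
  | .sqrt e => √(e.eval s)
  | .cos e => Real.cos (e.eval s)
  | .sin e => Real.sin (e.eval s)

def RExp.size : RExp → ℕ
  | .mem _ e => e.size + 1
  | .const _ => 1
  | .cast e => e.size + 1
  | .add e f => e.size + f.size + 1
  | .sub e f => e.size + f.size + 1
  | .mul e f => e.size + f.size + 1
  | .div e f => e.size + f.size + 1
  | .sqrt e => e.size + 1
  | .cos e => e.size + 1
  | .sin e => e.size + 1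

def Test.holds (s : State) : Test → Prop
  | .nle e f => e.eval s ≤ f.eval s
  | .rle e f => e.eval s ≤ f.eval s

def Test.size : Test → ℕ
  | .nle e f => e.size + f.size + 1
  | .rle e f => e.size + f.size + 1

/-- Spend `c` units of time. -/
def State.tick (s : State) (c : ℕ) : State := { s with time := s.time + c }

/-- Store a real number in entry `i` of array `a`. -/
def State.store (s : State) (a i : ℕ) (v : ℝ) : State :=
  { s with mem := Function.update s.mem a (Function.update (s.mem a) i v) }

/-- Store a vector in the entries `i, …, i + d - 1` of array `a`. -/
def State.storeVec {d : ℕ} (s : State) (a i : ℕ) (v : E d) : State :=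
  { s with
    mem := Function.update s.mem a fun l =>
      if h : i ≤ l ∧ l < i + d then v ⟨l - i, by omega⟩ else s.mem a l }

/-- Apply a gate all of whose qubits are allocated. -/
def State.gate (s : State) (G : Gate) (ok : Prop) [Decidable ok] : State :=
  if ok then { s with gates := s.gates ++ [G] } else s

open Classical in
/-- Execution of a program. -/
def exec {d : ℕ} (env : Env d) : Prog → State → State
  | .skip, s => s.tick 1
  | .setReg r e, s => { s.tick (e.size + 1) with reg := Function.update s.reg r (e.eval s) }
  | .setMem a i e, s => (s.tick (i.size + e.size + 1)).store a (i.eval s) (e.eval s)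
  | .seq c c', s => exec env c' (exec env c s)
  | .ite b c c', s =>
      if b.holds s then exec env c (s.tick (b.size + 1)) else exec env c' (s.tick (b.size + 1))
  | .loop e c, s => (fun s' => exec env c (s'.tick 1))^[e.eval s] (s.tick (e.size + 1))
  | .sample a i, s =>
      { (s.tick (i.size + env.t + d + 1)).storeVec a (i.eval s) (env.ω s.nsamp) with
        nsamp := s.nsamp + 1 }
  | .rand a i, s =>
      { (s.tick (i.size + 1)).store a (i.eval s) (env.u s.nrand : ℝ) with nrand := s.nrand + 1 }
  | .newQubit, s => { s.tick 1 with nqubit := s.nqubit + 1 }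
  | .gateX i, s => (s.tick (i.size + 1)).gate (.X (i.eval s)) (i.eval s < s.nqubit)
  | .gateH i, s => (s.tick (i.size + 1)).gate (.H (i.eval s)) (i.eval s < s.nqubit)
  | .gateS i, s => (s.tick (i.size + 1)).gate (.S (i.eval s)) (i.eval s < s.nqubit)
  | .gateT i, s => (s.tick (i.size + 1)).gate (.T (i.eval s)) (i.eval s < s.nqubit)
  | .gateCNOT i j, s =>
      (s.tick (i.size + j.size + 1)).gate (.CNOT (i.eval s) (j.eval s))
        (i.eval s < s.nqubit ∧ j.eval s < s.nqubit)

/-- The initial state: register `0` holds the dimension `d`, register `1` the number `m = D / 2` of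
samples to be used; everything else is empty. -/
def startState (d m : ℕ) : State where
  reg := fun r => if r = 0 then d else if r = 1 then m else 0
  mem := fun _ _ => 0
  nsamp := 0
  nrand := 0
  nqubit := 0
  gates := []
  time := 0

/-- Construct the feature map: run `build` on the input `(d, m)`. The resulting memory is the
stored description of the feature map. -/
def buildState {d : ℕ} (build : Prog) (m : ℕ) (env : Env d) : State :=
  exec env build (startState d m)

/-- Construct the feature map with `build`, then write the data point `x` to array `0` and
run `evaluate`. Its `time` is the total time of both phases. -/
def finalState {d : ℕ} (build evaluate : Prog) (m : ℕ) (env : Env d) (x : E d) : State :=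
  exec env evaluate ((buildState build m env).storeVec 0 0 x)

/-- The quantum state prepared by the machine, as a state of `n` qubits: the mixture of the final
pure states over the machine's uniform random numbers, for fixed samples `ω`. -/
def preparedState {d : ℕ} (build prepare : Prog) (m n t : ℕ) (ω : ℕ → E d) (x : E d) : QOp n :=
  Matrix.of fun b c =>
    ∫ u : ℕ → unitInterval,
      circuitState n (finalState build prepare m ⟨t, ω, u⟩ x).gates b *
        starRingEnd ℂ (circuitState n (finalState build prepare m ⟨t, ω, u⟩ x).gates c)
      ∂(Measure.infinitePi fun _ : ℕ => (volume : Measure unitInterval))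

/-- The programs `build` and `evaluate` implement random Fourier features: `build` constructs `z`
from exactly `m = D / 2` samples; afterwards, without further samples, `evaluate` writes the vector
`z(x)` to array `1`, for any data point `x`. -/
def ImplementsRFF (build evaluate : Prog) : Prop :=
  ∀ (d m : ℕ), 1 ≤ m → ∀ (env : Env d),
    (buildState build m env).nsamp = m ∧
    ∀ x : E d,
      (finalState build evaluate m env x).nsamp = m ∧
      ∀ i : Fin (2 * m), (finalState build evaluate m env x).mem 1 i = rffMap m env.ω x i

/-- The programs `build` and `prepare` implement quantum random Fourier features: `build` constructs
`z` from exactly `m = D / 2` samples; afterwards, without further samples, `prepare` allocates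
`⌈log₄ (D + 1)⌉` qubits and prepares on them the mixed state `ρ(x)`; it also writes the factor
`g(x)` to entry `0` of array `1`. -/
def ImplementsQRFF (build prepare : Prog) : Prop :=
  ∀ (d m : ℕ), 1 ≤ m →
    (∀ env : Env d, (buildState build m env).nsamp = m ∧
      ∀ x : E d,
        (finalState build prepare m env x).nsamp = m ∧
        (finalState build prepare m env x).nqubit = numQubits (2 * m) ∧
        (finalState build prepare m env x).mem 1 0 = rffNorm m env.ω x) ∧
    ∀ (t : ℕ) (ω : ℕ → E d) (x : E d),
      preparedState build prepare m (numQubits (2 * m)) t ω x = qrffState m ω x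

/-- Half the feature dimension: `D / 2 = ⌈C (d / ε²) (1 + log⁺ (R d √B / ε))⌉`. -/
def halfDim (C R B ε : ℝ) (d : ℕ) : ℕ :=
  ⌈C * (d / ε ^ 2) * (1 + Real.posLog (R * d * √B / ε))⌉₊

/-- The law of an i.i.d. sequence of samples from `p`. -/
def iidLaw {d : ℕ} (p : Measure (E d)) [IsProbabilityMeasure p] : Measure (ℕ → E d) :=
  Measure.infinitePi fun _ : ℕ => p

end QRFF

end

open QRFF

noncomputable section

namespace QRFF

/-! ## Static analysis of programs: frames, loop invariants, running time -/

/-! The proof has three ingredients: exact programs, an algebraic identity that reduces the quantum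
kernel to the classical one, and a uniform law of large numbers.

Programs. RFF is a direct computation. For QRFF the mixed states `2⁻ⁿ(1 ± Pᵢ)` are resolved further:
`Pᵢ` has a product eigenbasis `v_b` with eigenvalues `λ_b = ±1`, and both `1 = ∑ |v_b⟩⟨v_b|` and `Pᵢ
= ∑ λ_b |v_b⟩⟨v_b|` (`eigState_resolution`, `eigState_spectral`). Hence `ρ(x)` is the mixture of the
pure states `v_b` with weights `(|zᵢ| + zᵢ λ_b) / (g 2ⁿ)`, which are nonnegative and sum to 1
(`c2qe_apply_eq_sum_outcomeWeight`, `accWeight_total`). A single uniform number selects a pair `(i,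
b)` by inverse transform sampling (`integral_inverse_transform`), and at most one `X`, `H` and `S`
per qubit prepares `v_b` from `|0…0⟩` (`circuitState_eigGates`). Since `2ⁿ = O(D)`, all pairs can be
enumerated in polynomial time. Correctness comes from loop invariants (`exec_loop_inv`) together
with syntactic frame conditions. Run-time comes from a cost function read off the program text,
valid because loop bounds use only registers that the analysed program does not write
(`exec_time_le`).

Quantum to classical. Distinct Pauli operators are trace-orthogonal and the non-identity ones are
traceless, so `2ⁿ Tr(ρ_r ρ_r') - 1 = ⟨r, r'⟩` (`trace_c2qe_mul_c2qe`). After multiplication by the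
norms the corrected quantum kernel equals `⟨z(x), z(x')⟩` for every choice of frequencies
(`eqk_qrffState`). The two error events therefore coincide.

Uniform convergence. `⟨z(x), z(x')⟩` is the average of `cos⟨ω_j, Δ⟩` at `Δ = x - x'`, with mean
`k(Δ)`. The second derivatives at the origin control `E ωᵢ²` through Fatou's lemma
(`lintegral_sq_le`), hence `E ‖ω‖₁ ≤ d√(2B)`. This makes `k` Lipschitz in the sup norm and, by
Markov's inequality, bounds the random Lipschitz constant of the average. On a grid in `[-2R, 2R]^d`
with `N` points per axis, Hoeffding's inequality and a union bound cost `N^d · 2 exp(-mε²/8)`. A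
choice of `N` of order `1 + R d √B / (ε δ)` makes both failure probabilities at most `δ/2`
(`uniform_bound`, `exists_grid_size`); the factor `d (1 + log⁺(R d √B / ε))` in the number of
features is `d log N` up to constants depending on `δ`. -/

/-- Whether the program contains an instruction writing to register `r`. -/
def Prog.writesReg (r : ℕ) : Prog → Bool
  | .setReg r' _ => r' == r
  | .seq c c' => c.writesReg r || c'.writesReg r
  | .ite _ c c' => c.writesReg r || c'.writesReg r
  | .loop _ c => c.writesReg r
  | _ => false

/-- Whether the program contains an instruction writing to array `a`. -/
def Prog.writesMem (a : ℕ) : Prog → Bool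
  | .setMem a' _ _ => a' == a
  | .sample a' _ => a' == a
  | .rand a' _ => a' == a
  | .seq c c' => c.writesMem a || c'.writesMem a
  | .ite _ c c' => c.writesMem a || c'.writesMem a
  | .loop _ c => c.writesMem a
  | _ => false

/-- Whether the program contains a sampling instruction. -/
def Prog.samples : Prog → Bool
  | .sample _ _ => true
  | .seq c c' => c.samples || c'.samples
  | .ite _ c c' => c.samples || c'.samples
  | .loop _ c => c.samples
  | _ => false

/-- Whether the program contains an instruction drawing a uniform random number. -/
def Prog.rands : Prog → Bool
  | .rand _ _ => true
  | .seq c c' => c.rands || c'.rands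
  | .ite _ c c' => c.rands || c'.rands
  | .loop _ c => c.rands
  | _ => false

/-- Whether the program contains an instruction allocating a qubit. -/
def Prog.allocates : Prog → Bool
  | .newQubit => true
  | .seq c c' => c.allocates || c'.allocates
  | .ite _ c c' => c.allocates || c'.allocates
  | .loop _ c => c.allocates
  | _ => false

/-- Whether the program contains a gate instruction. -/
def Prog.appliesGates : Prog → Bool
  | .gateX _ => true
  | .gateH _ => true
  | .gateS _ => true
  | .gateT _ => true
  | .gateCNOT _ _ => true
  | .seq c c' => c.appliesGates || c'.appliesGates
  | .ite _ c c' => c.appliesGates || c'.appliesGates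
  | .loop _ c => c.appliesGates
  | _ => false

/-! ### Components of a state under the primitive operations. -/

section proj
variable (s : State) (k a i : ℕ) (v : ℝ) (G : Gate) (ok : Prop) [Decidable ok]

@[simp] lemma State.tick_reg : (s.tick k).reg = s.reg := rfl
@[simp] lemma State.tick_mem : (s.tick k).mem = s.mem := rfl
@[simp] lemma State.tick_nsamp : (s.tick k).nsamp = s.nsamp := rfl
@[simp] lemma State.tick_nrand : (s.tick k).nrand = s.nrand := rfl
@[simp] lemma State.tick_nqubit : (s.tick k).nqubit = s.nqubit := rfl
@[simp] lemma State.tick_gates : (s.tick k).gates = s.gates := rfl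
@[simp] lemma State.tick_time : (s.tick k).time = s.time + k := rfl
@[simp] lemma State.store_reg : (s.store a i v).reg = s.reg := rfl
@[simp] lemma State.store_mem :
    (s.store a i v).mem = Function.update s.mem a (Function.update (s.mem a) i v) := rfl
@[simp] lemma State.store_nsamp : (s.store a i v).nsamp = s.nsamp := rfl
@[simp] lemma State.store_nrand : (s.store a i v).nrand = s.nrand := rfl
@[simp] lemma State.store_nqubit : (s.store a i v).nqubit = s.nqubit := rfl
@[simp] lemma State.store_gates : (s.store a i v).gates = s.gates := rfl
@[simp] lemma State.store_time : (s.store a i v).time = s.time := rfl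
@[simp] lemma State.gate_reg : (s.gate G ok).reg = s.reg := by unfold State.gate; split <;> rfl
@[simp] lemma State.gate_mem : (s.gate G ok).mem = s.mem := by unfold State.gate; split <;> rfl
@[simp] lemma State.gate_nsamp : (s.gate G ok).nsamp = s.nsamp := by
  unfold State.gate; split <;> rfl
@[simp] lemma State.gate_nrand : (s.gate G ok).nrand = s.nrand := by
  unfold State.gate; split <;> rfl
@[simp] lemma State.gate_nqubit : (s.gate G ok).nqubit = s.nqubit := by
  unfold State.gate; split <;> rfl
@[simp] lemma State.gate_time : (s.gate G ok).time = s.time := by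
  unfold State.gate; split <;> rfl
lemma State.gate_gates_of (h : ok) : (s.gate G ok).gates = s.gates ++ [G] := by
  simp [State.gate, h]

variable {d : ℕ} (x : E d)

@[simp] lemma State.storeVec_reg : (s.storeVec a i x).reg = s.reg := rfl
@[simp] lemma State.storeVec_nsamp : (s.storeVec a i x).nsamp = s.nsamp := rfl
@[simp] lemma State.storeVec_nrand : (s.storeVec a i x).nrand = s.nrand := rfl
@[simp] lemma State.storeVec_nqubit : (s.storeVec a i x).nqubit = s.nqubit := rfl
@[simp] lemma State.storeVec_gates : (s.storeVec a i x).gates = s.gates := rfl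
@[simp] lemma State.storeVec_time : (s.storeVec a i x).time = s.time := rfl

lemma State.storeVec_mem_of_ne {a' : ℕ} (h : a' ≠ a) : (s.storeVec a i x).mem a' = s.mem a' := by
  simp [State.storeVec, h]

lemma State.storeVec_mem_add {l : ℕ} (h : l < d) :
    (s.storeVec a i x).mem a (i + l) = x ⟨l, h⟩ := by
  simp [State.storeVec, h]

lemma State.storeVec_mem_lt {l : ℕ} (h : l < i) :
    (s.storeVec a i x).mem a l = s.mem a l := by
  simp [State.storeVec, Nat.not_le.2 h]

end proj

lemma iterate_proj {α β : Type*} (π : α → β) {f : α → α} (h : ∀ s, π (f s) = π s) (n : ℕ) (s : α) :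
    π (f^[n] s) = π s := by
  induction n generalizing s with
  | zero => rfl
  | succ n ih => rw [Function.iterate_succ_apply, ih, h]

/-! ### Frame properties and loop invariants. -/

section frame
variable {d : ℕ} (env : Env d)

lemma exec_seq (c c' : Prog) (s : State) : exec env (.seq c c') s = exec env c' (exec env c s) :=
  rfl

lemma exec_setReg (r : ℕ) (e : NExp) (s : State) :
    exec env (.setReg r e) s =
      { s.tick (e.size + 1) with reg := Function.update s.reg r (e.eval s) } :=
  rfl

/-- Induction on the program; a loop is an iterate of a map that preserves the component. The
hypothesis is a Boolean computed from the syntax, so for a concrete program it is settled by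
`decide`. The frame lemmas below follow the same pattern and let the later proofs track only what a
stage changes. -/
lemma exec_reg {r : ℕ} {c : Prog} (h : c.writesReg r = false) (s : State) :
    (exec env c s).reg r = s.reg r := by
  induction c generalizing s with
  | seq c c' ih ih' => simp_all [Prog.writesReg, exec]
  | ite b c c' ih ih' => simp only [exec]; split <;> simp_all [Prog.writesReg]
  | loop e c ih =>
    simp only [exec]
    rw [iterate_proj (fun s : State => s.reg r) (fun s => by simp [ih h])]
    rfl
  | setReg r' e =>
    simp only [Prog.writesReg, beq_eq_false_iff_ne] at h
    simp [exec, Function.update_of_ne h.symm]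
  | _ => simp [exec]

lemma exec_mem {a : ℕ} {c : Prog} (h : c.writesMem a = false) (s : State) :
    (exec env c s).mem a = s.mem a := by
  induction c generalizing s with
  | seq c c' ih ih' => simp_all [Prog.writesMem, exec]
  | ite b c c' ih ih' => simp only [exec]; split <;> simp_all [Prog.writesMem]
  | loop e c ih =>
    simp only [exec]
    rw [iterate_proj (fun s : State => s.mem a) (fun s => by simp [ih h])]
    rfl
  | sample a' i =>
    simp only [Prog.writesMem, beq_eq_false_iff_ne] at h
    simp [exec, State.storeVec_mem_of_ne _ _ _ _ h.symm]
  | setMem a' i e =>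
    simp only [Prog.writesMem, beq_eq_false_iff_ne] at h
    simp [exec, Function.update_of_ne h.symm]
  | rand a' i =>
    simp only [Prog.writesMem, beq_eq_false_iff_ne] at h
    simp [exec, Function.update_of_ne h.symm]
  | _ => simp [exec]

lemma exec_nsamp {c : Prog} (h : c.samples = false) (s : State) :
    (exec env c s).nsamp = s.nsamp := by
  induction c generalizing s with
  | seq c c' ih ih' => simp_all [Prog.samples, exec]
  | ite b c c' ih ih' => simp only [exec]; split <;> simp_all [Prog.samples]
  | loop e c ih =>
    simp only [exec]
    rw [iterate_proj State.nsamp (fun s => by simp [ih h])]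
    rfl
  | _ => simp_all [Prog.samples, exec]

lemma exec_nrand {c : Prog} (h : c.rands = false) (s : State) :
    (exec env c s).nrand = s.nrand := by
  induction c generalizing s with
  | seq c c' ih ih' => simp_all [Prog.rands, exec]
  | ite b c c' ih ih' => simp only [exec]; split <;> simp_all [Prog.rands]
  | loop e c ih =>
    simp only [exec]
    rw [iterate_proj State.nrand (fun s => by simp [ih h])]
    rfl
  | _ => simp_all [Prog.rands, exec]

lemma exec_nqubit {c : Prog} (h : c.allocates = false) (s : State) :
    (exec env c s).nqubit = s.nqubit := by
  induction c generalizing s with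
  | seq c c' ih ih' => simp_all [Prog.allocates, exec]
  | ite b c c' ih ih' => simp only [exec]; split <;> simp_all [Prog.allocates]
  | loop e c ih =>
    simp only [exec]
    rw [iterate_proj State.nqubit (fun s => by simp [ih h])]
    rfl
  | _ => simp_all [Prog.allocates, exec]

lemma exec_gates {c : Prog} (h : c.appliesGates = false) (s : State) :
    (exec env c s).gates = s.gates := by
  induction c generalizing s with
  | seq c c' ih ih' => simp_all [Prog.appliesGates, exec]
  | ite b c c' ih ih' => simp only [exec]; split <;> simp_all [Prog.appliesGates]
  | loop e c ih =>
    simp only [exec]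
    rw [iterate_proj State.gates (fun s => by simp [ih h])]
    rfl
  | _ => simp_all [Prog.appliesGates, exec]

/-- Rule for loops: an invariant that may depend on the number of iterations done. -/
lemma exec_loop_inv (I : ℕ → State → Prop) {e : NExp} {c : Prog} {s : State} {n : ℕ}
    (hn : e.eval s = n) (h0 : I 0 (s.tick (e.size + 1)))
    (hstep : ∀ k < n, ∀ s', I k s' → I (k + 1) (exec env c (s'.tick 1))) :
    I n (exec env (.loop e c) s) := by
  subst hn
  simp only [exec]
  have key : ∀ k ≤ e.eval s,
      I k ((fun s' => exec env c (s'.tick 1))^[k] (s.tick (e.size + 1))) := by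
    intro k
    induction k with
    | zero => intro _; exact h0
    | succ k ih =>
      intro hk
      rw [Function.iterate_succ_apply']
      exact hstep k (by omega) _ (ih (by omega))
  exact key _ le_rfl

end frame

/-! ### Run-time bounds read off the program text. -/

/-- Whether an expression reads only registers from the list `R`. -/
def NExp.readsOnly (R : List ℕ) : NExp → Bool
  | .reg r => r ∈ R
  | .const _ => true
  | .add e f => e.readsOnly R && f.readsOnly R
  | .sub e f => e.readsOnly R && f.readsOnly R
  | .half e => e.readsOnly R

/-- Whether all loop bounds read only registers from `R`, and no instruction writes to these. -/
def Prog.boundedBy (R : List ℕ) : Prog → Bool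
  | .setReg r _ => r ∉ R
  | .seq c c' => c.boundedBy R && c'.boundedBy R
  | .ite _ c c' => c.boundedBy R && c'.boundedBy R
  | .loop e c => e.readsOnly R && c.boundedBy R
  | _ => true

/-- A bound on the running time of a program whose loop bounds are evaluated in the state `s`. -/
def Prog.cost (t d : ℕ) (s : State) : Prog → ℕ
  | .skip => 1
  | .setReg _ e => e.size + 1
  | .setMem _ i e => i.size + e.size + 1
  | .seq c c' => c.cost t d s + c'.cost t d s
  | .ite b c c' => b.size + 1 + (c.cost t d s + c'.cost t d s)
  | .loop e c => e.size + 1 + e.eval s * (1 + c.cost t d s)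
  | .sample _ i => i.size + t + d + 1
  | .rand _ i => i.size + 1
  | .newQubit => 1
  | .gateX i => i.size + 1
  | .gateH i => i.size + 1
  | .gateS i => i.size + 1
  | .gateT i => i.size + 1
  | .gateCNOT i j => i.size + j.size + 1

lemma NExp.eval_congr {R : List ℕ} {s s' : State} (h : ∀ r ∈ R, s.reg r = s'.reg r) {e : NExp}
    (he : e.readsOnly R = true) : e.eval s = e.eval s' := by
  induction e with
  | reg r => exact h r (by simpa [NExp.readsOnly] using he)
  | _ => simp_all [NExp.readsOnly, NExp.eval]

lemma Prog.cost_congr {R : List ℕ} {s s' : State} (h : ∀ r ∈ R, s.reg r = s'.reg r) {c : Prog}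
    (hc : c.boundedBy R = true) (t d : ℕ) : c.cost t d s = c.cost t d s' := by
  induction c with
  | loop e c ih =>
    simp only [Prog.boundedBy, Bool.and_eq_true] at hc
    simp [Prog.cost, ih hc.2, NExp.eval_congr h hc.1]
  | _ => simp_all [Prog.boundedBy, Prog.cost]

lemma Prog.boundedBy.exec_reg {R : List ℕ} {c : Prog} (hc : c.boundedBy R = true) {d : ℕ}
    (env : Env d) (s : State) {r : ℕ} (hr : r ∈ R) : (exec env c s).reg r = s.reg r := by
  apply QRFF.exec_reg
  induction c with
  | setReg r' e =>
    simp only [Prog.boundedBy, decide_eq_true_eq] at hc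
    simp only [Prog.writesReg, beq_eq_false_iff_ne]
    rintro rfl
    exact hc hr
  | _ => simp_all [Prog.boundedBy, Prog.writesReg]

/-- Every loop bound depends on registers in `R` only, and these never change during the run, so it
has the same value whenever the loop is reached and may be evaluated in the initial state. A
conditional is charged for both branches. -/
lemma exec_time_le {d : ℕ} (env : Env d) {R : List ℕ} {c : Prog} (hc : c.boundedBy R = true)
    (s : State) : (exec env c s).time ≤ s.time + c.cost env.t d s := by
  induction c generalizing s with
  | seq c c' ih ih' =>
    simp only [Prog.boundedBy, Bool.and_eq_true] at hc
    have h1 := ih hc.1 s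
    have h2 := ih' hc.2 (exec env c s)
    rw [Prog.cost_congr (R := R) (s' := s) (fun r hr => Prog.boundedBy.exec_reg hc.1 env s hr)
      hc.2] at h2
    simp only [exec, Prog.cost]
    omega
  | ite b c c' ih ih' =>
    simp only [Prog.boundedBy, Bool.and_eq_true] at hc
    have h1 := ih hc.1 (s.tick (b.size + 1))
    have h2 := ih' hc.2 (s.tick (b.size + 1))
    rw [Prog.cost_congr (R := R) (s := s.tick (b.size + 1)) (s' := s) (fun r hr => rfl) hc.1] at h1
    rw [Prog.cost_congr (R := R) (s := s.tick (b.size + 1)) (s' := s) (fun r hr => rfl) hc.2] at h2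
    simp only [State.tick_time] at h1 h2
    simp only [exec, Prog.cost]
    split <;> omega
  | loop e c ih =>
    simp only [Prog.boundedBy, Bool.and_eq_true] at hc
    have key := exec_loop_inv env (e := e) (c := c) (s := s) (n := e.eval s)
      (fun k s' => s'.time ≤ s.time + (e.size + 1) + k * (1 + c.cost env.t d s) ∧
        ∀ r ∈ R, s'.reg r = s.reg r) rfl ?_ ?_
    · have := key.1
      simp only [Prog.cost]
      omega
    · exact ⟨by simp, fun r _ => rfl⟩
    · rintro k - s' ⟨h1, h2⟩
      refine ⟨?_, fun r hr => ?_⟩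
      · have := ih hc.2 (s'.tick 1)
        rw [Prog.cost_congr (R := R) (s' := s) (fun r hr => by simpa using h2 r hr) hc.2] at this
        simp only [State.tick_time] at this
        rw [add_mul]
        omega
      · rw [Prog.boundedBy.exec_reg hc.2 env _ hr]
        exact h2 r hr
  | _ => simp [exec, Prog.cost, add_assoc]
/-! ## Programs for random Fourier features

Array `0` holds the data point, array `2` the frequencies (row after row), array `1` the feature
vector. -/

/-- Draw as many samples as register `1` says and store them in array `2`. -/
def storeSamples : Prog :=
  .loop (.reg 1) (.seq (.sample 2 (.reg 2)) (.setReg 2 (.add (.reg 2) (.reg 0))))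

/-- One step of the computation of an inner product. -/
def innerStep : Prog :=
  .seq (.setMem 3 (.const 0)
      (.add (.mem 3 (.const 0)) (.mul (.mem 2 (.reg 2)) (.mem 0 (.reg 3)))))
    (.seq (.setReg 2 (.add (.reg 2) (.const 1))) (.setReg 3 (.add (.reg 3) (.const 1))))

/-- Compute the inner product of the data point and the row of array `2` that starts at the entry
named by register `2`. -/
def innerProd : Prog :=
  .seq (.setMem 3 (.const 0) (.const 0)) (.seq (.setReg 3 (.const 0)) (.loop (.reg 0) innerStep))

/-- The factor `√(2 / D)`. -/
def scaleExp : RExp := .sqrt (.div (.const 2) (.cast (.add (.reg 1) (.reg 1))))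

/-- Compute the two features that belong to a frequency. -/
def featurePair : Prog :=
  .seq innerProd
    (.seq (.setMem 1 (.reg 4) (.mul scaleExp (.cos (.mem 3 (.const 0)))))
      (.seq (.setMem 1 (.add (.reg 4) (.const 1)) (.mul scaleExp (.sin (.mem 3 (.const 0)))))
        (.setReg 4 (.add (.reg 4) (.const 2)))))

/-- Write the feature vector of the data point to array `1`. -/
def computeFeatures : Prog :=
  .seq (.setReg 2 (.const 0)) (.seq (.setReg 4 (.const 0)) (.loop (.reg 1) featurePair))

/-! ### Correctness of the RFF programs. -/

section rff
variable {d : ℕ} (env : Env d)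

lemma exec_storeSamples {s : State} {m : ℕ} (h0 : s.reg 0 = d) (h1 : s.reg 1 = m)
    (h2 : s.reg 2 = 0) (hs : s.nsamp = 0) :
    (exec env storeSamples s).nsamp = m ∧
      ∀ j < m, ∀ l (hl : l < d), (exec env storeSamples s).mem 2 (j * d + l) = env.ω j ⟨l, hl⟩ := by
  have key := exec_loop_inv env (e := .reg 1)
    (c := .seq (.sample 2 (.reg 2)) (.setReg 2 (.add (.reg 2) (.reg 0)))) (s := s) (n := m)
    (fun k s' => s'.reg 0 = d ∧ s'.reg 2 = k * d ∧ s'.nsamp = k ∧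
      ∀ j < k, ∀ l (hl : l < d), s'.mem 2 (j * d + l) = env.ω j ⟨l, hl⟩) h1 ?_ ?_
  · exact key.2.2
  · simp [h0, h2, hs]
  · rintro k - s' ⟨i0, i2, is, im⟩
    refine ⟨?_, ?_, ?_, ?_⟩
    · simp [exec, i0]
    · simp [exec, NExp.eval, i0, i2, add_mul]
    · simp [exec, is]
    · intro j hj l hl
      simp only [exec, State.tick_mem, NExp.eval, State.tick_reg, State.tick_nsamp, i2, is]
      rcases Nat.lt_succ_iff_lt_or_eq.1 hj with hj | rfl
      · rw [State.storeVec_mem_lt]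
        · exact im j hj l hl
        -- Earlier rows survive: row `j < k` ends before entry `k * d`, where the new sample starts.
        · have : (j + 1) * d ≤ k * d := Nat.mul_le_mul_right _ hj
          rw [add_mul] at this
          omega
      · rw [State.storeVec_mem_add _ _ _ _ hl]

/-- The final value of register 2 matters as well: it points to the start of the next row, so
consecutive calls walk through the frequencies without any multiplication of indices. -/
lemma exec_innerProd (s : State) :
    (exec env innerProd s).mem 3 0 =
        ∑ l ∈ Finset.range (s.reg 0), s.mem 2 (s.reg 2 + l) * s.mem 0 l ∧
      (exec env innerProd s).reg 2 = s.reg 2 + s.reg 0 := by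
  simp only [innerProd, exec_seq]
  set s₁ := exec env (.setReg 3 (.const 0)) (exec env (.setMem 3 (.const 0) (.const 0)) s) with hs₁
  have key := exec_loop_inv env (e := .reg 0) (c := innerStep) (s := s₁) (n := s.reg 0)
    (fun k s' => s'.mem 0 = s.mem 0 ∧ s'.mem 2 = s.mem 2 ∧ s'.reg 2 = s.reg 2 + k ∧ s'.reg 3 = k ∧
      s'.mem 3 0 = ∑ l ∈ Finset.range k, s.mem 2 (s.reg 2 + l) * s.mem 0 l) ?_ ?_ ?_
  · exact ⟨key.2.2.2.2, key.2.2.1⟩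
  · simp [hs₁, exec, NExp.eval]
  · simp [hs₁, exec, NExp.eval, RExp.eval]
  · rintro k - s' ⟨i1, i2, i3, i4, i5⟩
    refine ⟨?_, ?_, ?_, ?_, ?_⟩
    · rw [exec_mem env (by decide)]; exact i1
    · rw [exec_mem env (by decide)]; exact i2
    · simp [innerStep, exec, NExp.eval, i3, add_assoc]
    · simp [innerStep, exec, NExp.eval, i4]
    · simp [innerStep, exec, NExp.eval, RExp.eval, i1, i2, i3, i4, i5, Finset.sum_range_succ]

lemma exec_featurePair (s : State) :
    let θ := ∑ l ∈ Finset.range (s.reg 0), s.mem 2 (s.reg 2 + l) * s.mem 0 l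
    let c := √(2 / ((2 * s.reg 1 : ℕ) : ℝ))
    (exec env featurePair s).mem 1 =
        Function.update (Function.update (s.mem 1) (s.reg 4) (c * Real.cos θ)) (s.reg 4 + 1)
          (c * Real.sin θ) ∧
      (exec env featurePair s).reg 2 = s.reg 2 + s.reg 0 ∧
      (exec env featurePair s).reg 4 = s.reg 4 + 2 := by
  intro θ c
  obtain ⟨h1, h2⟩ := exec_innerProd env s
  have h3 : (exec env innerProd s).mem 1 = s.mem 1 := exec_mem env (by decide) s
  have h4 : (exec env innerProd s).reg 4 = s.reg 4 := exec_reg env (by decide) s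
  have h5 : (exec env innerProd s).reg 1 = s.reg 1 := exec_reg env (by decide) s
  refine ⟨?_, ?_, ?_⟩
  · simp [featurePair, exec, NExp.eval, RExp.eval, scaleExp, h1, h3, h4, h5, θ, c, two_mul]
  · simp [featurePair, exec, NExp.eval, RExp.eval, h2]
  · simp [featurePair, exec, NExp.eval, RExp.eval, h4]

lemma exec_computeFeatures {s : State} {m : ℕ} {ω : ℕ → E d} {x : E d} (h0 : s.reg 0 = d)
    (h1 : s.reg 1 = m) (hω : ∀ j < m, ∀ l (hl : l < d), s.mem 2 (j * d + l) = ω j ⟨l, hl⟩)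
    (hx : ∀ l (hl : l < d), s.mem 0 l = x ⟨l, hl⟩) (i : Fin (2 * m)) :
    (exec env computeFeatures s).mem 1 i = rffMap m ω x i := by
  simp only [computeFeatures, exec_seq]
  set s₁ := exec env (.setReg 4 (.const 0)) (exec env (.setReg 2 (.const 0)) s) with hs₁
  have key := exec_loop_inv env (e := .reg 1) (c := featurePair) (s := s₁) (n := m)
    (fun k s' => s'.reg 0 = d ∧ s'.reg 1 = m ∧ s'.mem 0 = s.mem 0 ∧ s'.mem 2 = s.mem 2 ∧
      s'.reg 2 = k * d ∧ s'.reg 4 = 2 * k ∧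
      ∀ i : Fin (2 * m), (i : ℕ) < 2 * k → s'.mem 1 i = rffMap m ω x i) ?_ ?_ ?_
  · exact key.2.2.2.2.2.2 i i.2
  · simp [hs₁, exec, NExp.eval, h1]
  · simp [hs₁, exec, NExp.eval, h0, h1]
  · rintro k hk s' ⟨i1, i2, i3, i4, i5, i6, i7⟩
    obtain ⟨j1, j2, j3⟩ := exec_featurePair env (s'.tick 1)
    refine ⟨?_, ?_, ?_, ?_, ?_, ?_, ?_⟩
    · rw [exec_reg env (by decide)]; exact i1
    · rw [exec_reg env (by decide)]; exact i2
    · rw [exec_mem env (by decide)]; exact i3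
    · rw [exec_mem env (by decide)]; exact i4
    · rw [j2]; simp [i5, i1, add_mul]
    · rw [j3]; simp [i6, mul_add]
    · intro i hi
      have hθ : ∑ l ∈ Finset.range ((s'.tick 1).reg 0),
          (s'.tick 1).mem 2 ((s'.tick 1).reg 2 + l) * (s'.tick 1).mem 0 l = inner ℝ (ω k) x := by
        simp only [State.tick_reg, State.tick_mem, i1, i3, i4, i5]
        rw [Finset.sum_range, PiLp.inner_apply]
        refine Finset.sum_congr rfl fun l _ => ?_
        rw [hω k hk l l.2, hx l l.2]
        simp [mul_comm]
      rw [j1, hθ]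
      simp only [State.tick_reg, State.tick_mem, i2, i6]
      rcases lt_or_ge (i : ℕ) (2 * k) with h | h
      · rw [Function.update_of_ne (by omega), Function.update_of_ne (by omega), i7 i h]
      · rcases Nat.lt_or_ge (2 * k) i with h' | h'
        · have hi' : (i : ℕ) = 2 * k + 1 := by omega
          have e1 : (2 * k + 1) % 2 = 1 := by omega
          have e2 : (2 * k + 1) / 2 = k := by omega
          simp only [rffMap, hi', e1, e2]
          simp
        · have hi' : (i : ℕ) = 2 * k := by omega
          simp only [rffMap, hi']
          simp

variable (m : ℕ) (x : E d)

/-- The state in which the evaluation of the feature map starts. -/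
lemma loadedState_spec :
    let s := (buildState storeSamples m env).storeVec 0 0 x
    s.reg 0 = d ∧ s.reg 1 = m ∧ s.nsamp = m ∧ s.nrand = 0 ∧ s.nqubit = 0 ∧ s.gates = [] ∧
      (∀ j < m, ∀ l (hl : l < d), s.mem 2 (j * d + l) = env.ω j ⟨l, hl⟩) ∧
      ∀ l (hl : l < d), s.mem 0 l = x ⟨l, hl⟩ := by
  intro s
  obtain ⟨h1, h2⟩ := exec_storeSamples env (s := startState d m) (m := m) rfl rfl rfl rfl
  refine ⟨?_, ?_, h1, ?_, ?_, ?_, ?_, ?_⟩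
  · exact exec_reg env (by decide) _
  · exact exec_reg env (by decide) _
  · exact exec_nrand env (by decide) _
  · exact exec_nqubit env (by decide) _
  · exact exec_gates env (by decide) _
  · intro j hj l hl
    simp only [s]
    rw [State.storeVec_mem_of_ne _ _ _ _ (by decide)]
    exact h2 j hj l hl
  · intro l hl
    simpa using State.storeVec_mem_add (buildState storeSamples m env) 0 0 x hl

end rff

lemma implementsRFF : ImplementsRFF storeSamples computeFeatures := by
  intro d m _ env
  -- Loading a data point does not affect the sample counter, so the point `0` serves as a dummy.
  refine ⟨(loadedState_spec env m 0).2.2.1, fun x => ?_⟩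
  obtain ⟨h0, h1, hs, -, -, -, hω, hx⟩ := loadedState_spec env m x
  exact ⟨(exec_nsamp env (by decide) _).trans hs, exec_computeFeatures env h0 h1 hω hx⟩
/-! ## The program for quantum random Fourier features -/

/-- The remainder modulo `2`. -/
def NExp.mod2 (e : NExp) : NExp := .sub e (.add (.half e) (.half e))

/-- The quotient by `4`. -/
def NExp.div4 (e : NExp) : NExp := .half (.half e)

/-- The remainder modulo `4`. -/
def NExp.mod4 (e : NExp) : NExp :=
  .sub e (.add (.add e.div4 e.div4) (.add e.div4 e.div4))

@[simp] lemma NExp.eval_mod2 (s : State) (e : NExp) : e.mod2.eval s = e.eval s % 2 := by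
  simp only [NExp.mod2, NExp.eval]; omega

@[simp] lemma NExp.eval_div4 (s : State) (e : NExp) : e.div4.eval s = e.eval s / 4 := by
  simp only [NExp.div4, NExp.eval]; omega

@[simp] lemma NExp.eval_mod4 (s : State) (e : NExp) : e.mod4.eval s = e.eval s % 4 := by
  simp only [NExp.mod4, NExp.eval, NExp.eval_div4]; omega

/-- `D = 2 m`. -/
def dimExp : NExp := .add (.reg 1) (.reg 1)

/-- The absolute value of the feature whose index is in register `r`. -/
def absExp (r : ℕ) : RExp := .sqrt (.mul (.mem 1 (.reg r)) (.mem 1 (.reg r)))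

/-- One step of the computation of the `1`-norm. -/
def normStep : Prog :=
  .seq (.setMem 4 (.const 0) (.add (.mem 4 (.const 0)) (absExp 3)))
    (.setReg 3 (.add (.reg 3) (.const 1)))

/-- Write the `1`-norm of the feature vector to entry `0` of array `4`. -/
def computeNorm : Prog :=
  .seq (.setMem 4 (.const 0) (.const 0)) (.seq (.setReg 3 (.const 0)) (.loop dimExp normStep))

/-- Allocate a qubit unless `4 ^ n ≥ D + 1`. -/
def allocStep : Prog :=
  .ite (.nle (.add dimExp (.const 1)) (.reg 6)) .skip
    (.seq .newQubit (.seq (.setReg 5 (.add (.reg 5) (.const 1)))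
      (.seq (.setReg 6 (.add (.add (.reg 6) (.reg 6)) (.add (.reg 6) (.reg 6))))
        (.setReg 7 (.add (.reg 7) (.reg 7))))))

/-- Allocate `n = ⌈log₄ (D + 1)⌉` qubits; write `n` to register `5` and `2 ^ n` to register `7`. -/
def allocQubits : Prog :=
  .seq (.setReg 5 (.const 0)) (.seq (.setReg 6 (.const 1)) (.seq (.setReg 7 (.const 1))
    (.loop dimExp allocStep)))

/-- Multiply the sign by the contribution of one qubit. -/
def signStep : Prog :=
  -- The subtractions are truncated. For digit `a = 0` the term `β - (1 - a)` vanishes for both bits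
  -- `β`, since the identity has eigenvalue 1 only; for `a ≥ 1` it equals `β`, which gives the sign
  -- `(-1)^β`.
  .seq (.setMem 6 (.const 0) (.mul (.mem 6 (.const 0)) (.sub (.const 1) (.mul (.const 2)
      (.cast (.sub (NExp.mod2 (.reg 11)) (.sub (.const 1) (NExp.mod4 (.reg 10)))))))))
    (.seq (.setReg 10 (NExp.div4 (.reg 10))) (.setReg 11 (.half (.reg 11))))

/-- Compute the eigenvalue of the Pauli operator named by register `8` at the eigenvector named by
register `9`. -/
def computeSign : Prog :=
  .seq (.setMem 6 (.const 0) (.const 1)) (.seq (.setReg 10 (.add (.reg 8) (.const 1)))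
    (.seq (.setReg 11 (.reg 9)) (.loop (.reg 5) signStep)))

/-- The probability of an outcome. -/
def weightExp : RExp :=
  .div (.add (absExp 8) (.mul (.mem 1 (.reg 8)) (.mem 6 (.const 0))))
    (.mul (.mem 4 (.const 0)) (.cast (.reg 7)))

/-- Select the current outcome if the uniform random number exceeds the accumulated probability, and
update the latter. -/
def outcomeStep : Prog :=
  .seq computeSign
    (.seq (.ite (.rle (.mem 5 (.const 0)) (.mem 5 (.const 1))) .skip
        (.seq (.setReg 12 (.add (.reg 8) (.const 1))) (.setReg 13 (.reg 9))))
      (.seq (.setMem 5 (.const 1) (.add (.mem 5 (.const 1)) weightExp))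
        (.setReg 9 (.add (.reg 9) (.const 1)))))

/-- Go through all eigenvectors of a Pauli operator. -/
def pauliStep : Prog :=
  .seq (.setReg 9 (.const 0)) (.seq (.loop (.reg 7) outcomeStep)
    (.setReg 8 (.add (.reg 8) (.const 1))))

/-- Choose a Pauli operator and one of its eigenvectors at random. -/
def chooseOutcome : Prog :=
  .seq (.setMem 5 (.const 1) (.const 0)) (.seq (.setReg 8 (.const 0)) (.loop dimExp pauliStep))

/-- Apply the gates to one qubit. -/
def qubitStep : Prog :=
  .seq (.ite (.nle (.const 1) (NExp.mod2 (.reg 11))) (.gateX (.reg 3)) .skip)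
    (.seq (.ite (.nle (.const 1) (NExp.mod4 (.reg 10)))
        (.ite (.nle (NExp.mod4 (.reg 10)) (.const 2))
          (.seq (.gateH (.reg 3))
            (.ite (.nle (.const 2) (NExp.mod4 (.reg 10))) (.gateS (.reg 3)) .skip)) .skip) .skip)
      (.seq (.setReg 3 (.add (.reg 3) (.const 1)))
        (.seq (.setReg 10 (NExp.div4 (.reg 10))) (.setReg 11 (.half (.reg 11))))))

/-- Prepare the chosen eigenvector. -/
def applyGates : Prog :=
  .seq (.setReg 3 (.const 0)) (.seq (.setReg 10 (.reg 12)) (.seq (.setReg 11 (.reg 13))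
    (.loop (.reg 5) qubitStep)))

/-- Everything after the allocation of the qubits. -/
def prepareEigenvector : Prog :=
  .seq (.rand 5 (.const 0)) (.seq chooseOutcome
    (.seq applyGates (.setMem 1 (.const 0) (.mem 4 (.const 0)))))

/-- Prepare the state `ρ(x)` and compute `g(x)`. -/
def prepareState : Prog :=
  .seq computeFeatures (.seq computeNorm (.seq allocQubits prepareEigenvector))

/-- Eigenvalue of the Pauli matrix `a` at its eigenvector number `β`. -/
def digitSign (a β : ℕ) : ℝ := 1 - 2 * ((β - (1 - a) : ℕ) : ℝ)

/-- Eigenvalue of the Pauli operator `i` at its eigenvector number `b`. -/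
def eigSign (n i b : ℕ) : ℝ := ∏ j ∈ Finset.range n, digitSign (i / 4 ^ j % 4) (b / 2 ^ j % 2)

/-- The gates that turn `|0⟩` into eigenvector number `β` of the Pauli matrix `a`. -/
def qubitGates (j a β : ℕ) : List Gate :=
  (if 1 ≤ β then [.X j] else []) ++
    if 1 ≤ a ∧ a ≤ 2 then .H j :: (if 2 ≤ a then [.S j] else []) else []

/-- The gates that turn `|0…0⟩` into eigenvector number `b` of the Pauli operator `i`. -/
def eigGates (n i b : ℕ) : List Gate :=
  (List.range n).flatMap fun j => qubitGates j (i / 4 ^ j % 4) (b / 2 ^ j % 2)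

/-- The probability with which eigenvector number `b` of the Pauli operator `i + 1` is prepared. -/
def outcomeWeight (n : ℕ) (z : ℕ → ℝ) (g : ℝ) (i b : ℕ) : ℝ :=
  (√(z i * z i) + z i * eigSign n (i + 1) b) / (g * (2 ^ n : ℕ))

/-- The probability of the first `k` outcomes. -/
def accWeight (n : ℕ) (z : ℕ → ℝ) (g : ℝ) (k : ℕ) : ℝ :=
  ∑ l ∈ Finset.range k, outcomeWeight n z g (l / 2 ^ n) (l % 2 ^ n)

/-! ### Correctness of the stages of the QRFF program. -/

section qrff
variable {d : ℕ} (env : Env d)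

lemma exec_computeNorm (s : State) :
    (exec env computeNorm s).mem 4 0 = ∑ i ∈ Finset.range (2 * s.reg 1), |s.mem 1 i| := by
  simp only [computeNorm, exec_seq]
  set s₁ := exec env (.setReg 3 (.const 0)) (exec env (.setMem 4 (.const 0) (.const 0)) s) with hs₁
  have key := exec_loop_inv env (e := dimExp) (c := normStep) (s := s₁) (n := 2 * s.reg 1)
    (fun k s' => s'.mem 1 = s.mem 1 ∧ s'.reg 3 = k ∧
      s'.mem 4 0 = ∑ i ∈ Finset.range k, |s.mem 1 i|) ?_ ?_ ?_
  · exact key.2.2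
  · simp [hs₁, exec, NExp.eval, dimExp, two_mul]
  · simp [hs₁, exec, NExp.eval, RExp.eval]
  · rintro k - s' ⟨i1, i2, i3⟩
    refine ⟨?_, ?_, ?_⟩
    · rw [exec_mem env (by decide)]; exact i1
    · simp [normStep, exec, NExp.eval, i2]
    · simp [normStep, exec, NExp.eval, RExp.eval, absExp, i1, i2, i3, Finset.sum_range_succ,
        Real.sqrt_mul_self_eq_abs]

/-- The machine has only counted loops. This shows that `D` passes suffice to allocate all qubits;
in the surplus passes `allocStep` does nothing, whence the `min k N` in the invariant of
`exec_allocQubits`. -/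
lemma numQubits_le (m : ℕ) : numQubits (2 * m) ≤ 2 * m := by
  refine Nat.clog_le_of_le_pow ?_
  calc 2 * m + 1 ≤ 2 ^ (2 * m) := Nat.lt_two_pow_self
    _ ≤ 4 ^ (2 * m) := Nat.pow_le_pow_left (by norm_num) _

lemma exec_allocQubits {s : State} {m : ℕ} (h1 : s.reg 1 = m) (hq : s.nqubit = 0) :
    let s' := exec env allocQubits s
    s'.nqubit = numQubits (2 * m) ∧ s'.reg 5 = numQubits (2 * m) ∧
      s'.reg 7 = 2 ^ numQubits (2 * m) := by
  simp only [allocQubits, exec_seq]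
  set s₁ := exec env (.setReg 7 (.const 1))
    (exec env (.setReg 6 (.const 1)) (exec env (.setReg 5 (.const 0)) s)) with hs₁
  set N := numQubits (2 * m) with hN
  have key := exec_loop_inv env (e := dimExp) (c := allocStep) (s := s₁) (n := 2 * m)
    (fun k s' => s'.reg 1 = m ∧ s'.nqubit = min k N ∧ s'.reg 5 = min k N ∧
      s'.reg 6 = 4 ^ min k N ∧ s'.reg 7 = 2 ^ min k N) ?_ ?_ ?_
  · have hle : N ≤ 2 * m := numQubits_le m
    rw [min_eq_right hle] at key
    exact ⟨key.2.1, key.2.2.1, key.2.2.2.2⟩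
  · simp [hs₁, exec, NExp.eval, dimExp, two_mul, h1]
  · simp [hs₁, exec, NExp.eval, h1, hq]
  · rintro k - s' ⟨i1, i2, i3, i4, i5⟩
    by_cases hk : N ≤ k
    · have hc : 2 * m + 1 ≤ 4 ^ N := Nat.le_pow_clog (by norm_num) _
      have hb : (Test.nle (.add dimExp (.const 1)) (.reg 6)).holds (s'.tick 1) := by
        simp only [Test.holds, NExp.eval, dimExp, State.tick_reg, i1, i4, min_eq_right hk]
        omega
      have e1 : min k N = N := min_eq_right hk
      have e2 : min (k + 1) N = N := min_eq_right (by omega)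
      simp only [allocStep, exec, if_pos hb]
      simp [i1, i2, i3, i4, i5, e1, e2]
    · have e1 : min k N = k := min_eq_left (by omega)
      have e2 : min (k + 1) N = k + 1 := min_eq_left (by omega)
      have hc : 4 ^ k < 2 * m + 1 := Nat.pow_lt_of_lt_clog (not_le.1 hk)
      have hb : ¬ (Test.nle (.add dimExp (.const 1)) (.reg 6)).holds (s'.tick 1) := by
        simp only [Test.holds, NExp.eval, dimExp, State.tick_reg, i1, i4, e1]
        omega
      simp only [allocStep, exec, if_neg hb]
      simp [i1, i2, i3, i4, i5, e1, e2, NExp.eval, pow_succ]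
      constructor <;> ring

lemma exec_computeSign (s : State) :
    (exec env computeSign s).mem 6 0 = eigSign (s.reg 5) (s.reg 8 + 1) (s.reg 9) := by
  simp only [computeSign, exec_seq]
  set s₁ := exec env (.setReg 11 (.reg 9)) (exec env (.setReg 10 (.add (.reg 8) (.const 1)))
    (exec env (.setMem 6 (.const 0) (.const 1)) s)) with hs₁
  have key := exec_loop_inv env (e := .reg 5) (c := signStep) (s := s₁) (n := s.reg 5)
    (fun k s' => s'.reg 10 = (s.reg 8 + 1) / 4 ^ k ∧ s'.reg 11 = s.reg 9 / 2 ^ k ∧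
      s'.mem 6 0 = eigSign k (s.reg 8 + 1) (s.reg 9)) ?_ ?_ ?_
  · exact key.2.2
  · simp [hs₁, exec, NExp.eval]
  · simp [hs₁, exec, NExp.eval, RExp.eval, eigSign]
  · rintro k - s' ⟨i1, i2, i3⟩
    refine ⟨?_, ?_, ?_⟩
    · simp [signStep, exec, NExp.eval, i1, Nat.div_div_eq_div_mul, pow_succ]
    · simp [signStep, exec, NExp.eval, i2, Nat.div_div_eq_div_mul, pow_succ]
    · simp [signStep, exec, NExp.eval, RExp.eval, i1, i2, i3, eigSign, Finset.prod_range_succ,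
        digitSign]

lemma exec_outcomeStep (s : State) {n : ℕ} (h5 : s.reg 5 = n) (h7 : s.reg 7 = 2 ^ n) :
    let s' := exec env outcomeStep s
    s'.mem 5 0 = s.mem 5 0 ∧
      s'.mem 5 1 = s.mem 5 1 + outcomeWeight n (s.mem 1) (s.mem 4 0) (s.reg 8) (s.reg 9) ∧
      s'.reg 9 = s.reg 9 + 1 ∧
      s'.reg 12 = (if s.mem 5 0 ≤ s.mem 5 1 then s.reg 12 else s.reg 8 + 1) ∧
      s'.reg 13 = (if s.mem 5 0 ≤ s.mem 5 1 then s.reg 13 else s.reg 9) := by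
  have h6 := exec_computeSign env s
  set s₁ := exec env computeSign s with hs₁
  have m1 : s₁.mem 1 = s.mem 1 := exec_mem env (by decide) s
  have m4 : s₁.mem 4 = s.mem 4 := exec_mem env (by decide) s
  have m5 : s₁.mem 5 = s.mem 5 := exec_mem env (by decide) s
  have r7 : s₁.reg 7 = s.reg 7 := exec_reg env (by decide) s
  have r8 : s₁.reg 8 = s.reg 8 := exec_reg env (by decide) s
  have r9 : s₁.reg 9 = s.reg 9 := exec_reg env (by decide) s
  have r12 : s₁.reg 12 = s.reg 12 := exec_reg env (by decide) s
  have r13 : s₁.reg 13 = s.reg 13 := exec_reg env (by decide) s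
  simp only [outcomeStep, exec_seq]
  rw [← hs₁]
  by_cases hu : s.mem 5 0 ≤ s.mem 5 1
  · have hb : (Test.rle (.mem 5 (.const 0)) (.mem 5 (.const 1))).holds s₁ := by
      simpa [Test.holds, RExp.eval, NExp.eval, m5] using hu
    simp [exec, if_pos hb, hu, NExp.eval, RExp.eval, weightExp, absExp, m1, m4, m5, r7, r8, r9,
      r12, r13, h6, h5, h7, outcomeWeight]
  · have hb : ¬ (Test.rle (.mem 5 (.const 0)) (.mem 5 (.const 1))).holds s₁ := by
      simpa [Test.holds, RExp.eval, NExp.eval, m5] using hu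
    simp [exec, if_neg hb, hu, NExp.eval, RExp.eval, weightExp, absExp, m1, m4, m5, r7, r8, r9,
      h6, h5, h7, outcomeWeight]

/-- The pairs `(i, b)` are enumerated lexicographically by the flat index `i * 2 ^ n + b`; this
matches the nested loops with the single sum defining `accWeight`. -/
lemma accWeight_succ (n : ℕ) (z : ℕ → ℝ) (g : ℝ) {i b : ℕ} (hb : b < 2 ^ n) :
    accWeight n z g (i * 2 ^ n + b + 1) =
      accWeight n z g (i * 2 ^ n + b) + outcomeWeight n z g i b := by
  have e1 : (i * 2 ^ n + b) / 2 ^ n = i := by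
    rw [mul_comm, Nat.mul_add_div (by positivity), Nat.div_eq_of_lt hb, add_zero]
  have e2 : (i * 2 ^ n + b) % 2 ^ n = b := by
    rw [mul_comm, Nat.mul_add_mod, Nat.mod_eq_of_lt hb]
  rw [accWeight, Finset.sum_range_succ, e1, e2, accWeight]

/-- After `k` outcomes, the accumulated probability is right, and so is the selection if the
uniform random number belongs to one of these outcomes. -/
def Selected (n : ℕ) (z : ℕ → ℝ) (g u : ℝ) (k : ℕ) (s : State) : Prop :=
  s.reg 5 = n ∧ s.reg 7 = 2 ^ n ∧ s.mem 1 = z ∧ s.mem 4 0 = g ∧ s.mem 5 0 = u ∧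
    s.mem 5 1 = accWeight n z g k ∧
    ∀ l < k, accWeight n z g l < u → u ≤ accWeight n z g (l + 1) →
      s.reg 12 = l / 2 ^ n + 1 ∧ s.reg 13 = l % 2 ^ n

lemma exec_outcomeStep_selected {n : ℕ} {z : ℕ → ℝ} {g u : ℝ} (hW : Monotone (accWeight n z g))
    {s : State} {i b : ℕ} (hb : b < 2 ^ n) (h8 : s.reg 8 = i) (h9 : s.reg 9 = b)
    (h : Selected n z g u (i * 2 ^ n + b) s) :
    Selected n z g u (i * 2 ^ n + (b + 1)) (exec env outcomeStep s) := by
  obtain ⟨h5, h7, m1, m4, m50, m51, hsel⟩ := h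
  obtain ⟨k1, k2, -, k4, k5⟩ := exec_outcomeStep env s h5 h7
  rw [← add_assoc]
  refine ⟨?_, ?_, ?_, ?_, k1.trans m50, ?_, ?_⟩
  · rw [exec_reg env (by decide)]; exact h5
  · rw [exec_reg env (by decide)]; exact h7
  · rw [exec_mem env (by decide)]; exact m1
  · rw [exec_mem env (by decide)]; exact m4
  · rw [k2, accWeight_succ n z g hb, m51, m1, m4, h8, h9]
  · intro l hl hl1 hl2
    rw [k4, k5, m50, m51]
    rcases Nat.lt_succ_iff_lt_or_eq.1 hl with hl | rfl
    -- The program keeps the last outcome whose preceding total is below `u`. By monotonicity, once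
    -- `u` has been reached no later outcome overwrites the selection.
    · have : u ≤ accWeight n z g (i * 2 ^ n + b) := hl2.trans (hW hl)
      simpa [this] using hsel l hl hl1 hl2
    · rw [if_neg (not_le.2 hl1), if_neg (not_le.2 hl1), h8, h9]
      rw [mul_comm, Nat.mul_add_div (by positivity), Nat.div_eq_of_lt hb, Nat.mul_add_mod,
        Nat.mod_eq_of_lt hb]
      simp

lemma exec_pauliStep_selected {n : ℕ} {z : ℕ → ℝ} {g u : ℝ} (hW : Monotone (accWeight n z g))
    {s : State} {i : ℕ} (h8 : s.reg 8 = i) (h : Selected n z g u (i * 2 ^ n) s) :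
    Selected n z g u ((i + 1) * 2 ^ n) (exec env pauliStep s) ∧
      (exec env pauliStep s).reg 8 = i + 1 := by
  simp only [pauliStep, exec_seq]
  set s₁ := exec env (.setReg 9 (.const 0)) s with hs₁
  have key := exec_loop_inv env (e := .reg 7) (c := outcomeStep) (s := s₁) (n := 2 ^ n)
    (fun b s' => s'.reg 8 = i ∧ s'.reg 9 = b ∧ Selected n z g u (i * 2 ^ n + b) s') ?_ ?_ ?_
  · obtain ⟨k1, -, k3⟩ := key
    rw [add_mul, one_mul]
    exact ⟨by simpa [exec, Selected] using k3, by simp [exec_setReg, NExp.eval, k1]⟩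
  · simp [hs₁, exec, NExp.eval, h.2.1]
  · exact ⟨by simp [hs₁, exec, h8], by simp [hs₁, exec, NExp.eval],
      by simpa [hs₁, exec, Selected] using h⟩
  · rintro b hb s' ⟨i1, i2, i3⟩
    refine ⟨?_, ?_, ?_⟩
    · rw [exec_reg env (by decide)]; exact i1
    · rw [(exec_outcomeStep env (s'.tick 1) i3.1 i3.2.1).2.2.1]; simp [i2]
    · exact exec_outcomeStep_selected env hW hb i1 i2 i3

/-- The selected outcome is the one whose half-open interval of accumulated weights contains `u`.
Register 12 is shifted by one because Pauli operator 0 is the identity, whereas features are indexed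
from 0. -/
lemma exec_chooseOutcome {n m : ℕ} {z : ℕ → ℝ} {g u : ℝ} (hW : Monotone (accWeight n z g))
    {s : State} (h1 : s.reg 1 = m) (h5 : s.reg 5 = n) (h7 : s.reg 7 = 2 ^ n) (hz : s.mem 1 = z)
    (hg : s.mem 4 0 = g) (hu : s.mem 5 0 = u) {k : ℕ} (hk : k < 2 * m * 2 ^ n)
    (hk1 : accWeight n z g k < u) (hk2 : u ≤ accWeight n z g (k + 1)) :
    (exec env chooseOutcome s).reg 12 = k / 2 ^ n + 1 ∧
      (exec env chooseOutcome s).reg 13 = k % 2 ^ n := by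
  simp only [chooseOutcome, exec_seq]
  set s₁ := exec env (.setReg 8 (.const 0)) (exec env (.setMem 5 (.const 1) (.const 0)) s) with hs₁
  have key := exec_loop_inv env (e := dimExp) (c := pauliStep) (s := s₁) (n := 2 * m)
    (fun i s' => s'.reg 8 = i ∧ Selected n z g u (i * 2 ^ n) s') ?_ ?_ ?_
  · exact key.2.2.2.2.2.2.2 k hk hk1 hk2
  · simp [hs₁, exec, NExp.eval, dimExp, two_mul, h1]
  · simp [hs₁, exec, NExp.eval, RExp.eval, Selected, h5, h7, hz, hg, hu, accWeight]
  · rintro i - s' ⟨i1, i2⟩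
    exact (exec_pauliStep_selected env hW (s := s'.tick 1) i1 i2).symm

lemma exec_qubitStep {s : State} (h : s.reg 3 < s.nqubit) :
    (exec env qubitStep s).gates =
      s.gates ++ qubitGates (s.reg 3) (s.reg 10 % 4) (s.reg 11 % 2) := by
  by_cases h1 : 1 ≤ s.reg 11 % 2 <;> by_cases h2 : 1 ≤ s.reg 10 % 4 <;>
    by_cases h3 : s.reg 10 % 4 ≤ 2 <;> by_cases h4 : 2 ≤ s.reg 10 % 4 <;>
    simp [qubitStep, exec, Test.holds, NExp.eval, State.gate_gates_of, qubitGates, h, h1, h2, h3,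
      h4]

lemma exec_applyGates {s : State} (h5 : s.reg 5 = s.nqubit) (hg : s.gates = []) :
    (exec env applyGates s).gates = eigGates s.nqubit (s.reg 12) (s.reg 13) := by
  simp only [applyGates, exec_seq]
  set s₁ := exec env (.setReg 11 (.reg 13)) (exec env (.setReg 10 (.reg 12))
    (exec env (.setReg 3 (.const 0)) s)) with hs₁
  have key := exec_loop_inv env (e := .reg 5) (c := qubitStep) (s := s₁) (n := s.nqubit)
    (fun k s' => s'.nqubit = s.nqubit ∧ s'.reg 3 = k ∧ s'.reg 10 = s.reg 12 / 4 ^ k ∧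
      s'.reg 11 = s.reg 13 / 2 ^ k ∧ s'.gates = eigGates k (s.reg 12) (s.reg 13)) ?_ ?_ ?_
  · exact key.2.2.2.2
  · simp [hs₁, exec, NExp.eval, h5]
  · simp [hs₁, exec, NExp.eval, eigGates, hg]
  · rintro k hk s' ⟨i1, i2, i3, i4, i5⟩
    -- Only the three register updates at the end are exposed; the branches applying gates stay
    -- opaque and are handled by the frame lemmas.
    have e : qubitStep = .seq _ (.seq _ (.seq (.setReg 3 (.add (.reg 3) (.const 1)))
        (.seq (.setReg 10 (NExp.div4 (.reg 10))) (.setReg 11 (.half (.reg 11)))))) := rfl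
    have r3 : (exec env qubitStep (s'.tick 1)).reg 3 = k + 1 := by
      rw [e]
      simp only [exec_seq]
      simp [exec_setReg, NExp.eval]
      rw [exec_reg env (by decide), exec_reg env (by decide)]
      simp [i2]
    have r10 : (exec env qubitStep (s'.tick 1)).reg 10 = s.reg 12 / 4 ^ (k + 1) := by
      rw [e]
      simp only [exec_seq]
      simp [exec_setReg, NExp.eval]
      rw [exec_reg env (by decide), exec_reg env (by decide)]
      simp [i3, Nat.div_div_eq_div_mul, pow_succ]
    have r11 : (exec env qubitStep (s'.tick 1)).reg 11 = s.reg 13 / 2 ^ (k + 1) := by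
      rw [e]
      simp only [exec_seq]
      simp [exec_setReg, NExp.eval]
      rw [exec_reg env (by decide), exec_reg env (by decide)]
      simp [i4, Nat.div_div_eq_div_mul, pow_succ]
    refine ⟨?_, r3, r10, r11, ?_⟩
    · rw [exec_nqubit env (by decide)]; exact i1
    · rw [exec_qubitStep env (by simp [i1, i2, hk])]
      simp [i2, i3, i4, i5, eigGates, List.range_succ]

end qrff
/-! ## The result of the program for quantum random Fourier features -/

lemma abs_digitSign {a β : ℕ} (h : β ≤ 1) : |digitSign a β| = 1 := by
  have : β - (1 - a) = 0 ∨ β - (1 - a) = 1 := by omega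
  rcases this with h | h <;> norm_num [digitSign, h]

lemma abs_eigSign (n i b : ℕ) : |eigSign n i b| = 1 := by
  rw [eigSign, Finset.abs_prod]
  exact Finset.prod_eq_one fun j _ => abs_digitSign (by omega)

/-- The eigenvalue is `±1`, so the numerator is either `2|zᵢ|` or `0`: only eigenvectors whose
eigenvalue agrees with the sign of `zᵢ` carry weight. -/
lemma outcomeWeight_nonneg (n : ℕ) (z : ℕ → ℝ) {g : ℝ} (hg : 0 ≤ g) (i b : ℕ) :
    0 ≤ outcomeWeight n z g i b := by
  refine div_nonneg ?_ (by positivity)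
  have h : |z i * eigSign n (i + 1) b| = |z i| := by rw [abs_mul, abs_eigSign, mul_one]
  rw [Real.sqrt_mul_self_eq_abs]
  have := neg_abs_le (z i * eigSign n (i + 1) b)
  linarith

lemma accWeight_mono (n : ℕ) (z : ℕ → ℝ) {g : ℝ} (hg : 0 ≤ g) : Monotone (accWeight n z g) := by
  refine monotone_nat_of_le_succ fun k => ?_
  rw [accWeight, accWeight, Finset.sum_range_succ]
  exact le_add_of_nonneg_right (outcomeWeight_nonneg n z hg _ _)

/-- Allows the machine's array, whose contents beyond entry `D` are not tracked, to be replaced by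
the feature vector extended by zero. -/
lemma accWeight_congr {n D : ℕ} {z z' : ℕ → ℝ} (h : ∀ i < D, z i = z' i) (g : ℝ) {k : ℕ}
    (hk : k ≤ D * 2 ^ n) : accWeight n z g k = accWeight n z' g k := by
  refine Finset.sum_congr rfl fun l hl => ?_
  have : l / 2 ^ n < D := by
    rw [Nat.div_lt_iff_lt_mul (by positivity)]
    exact (Finset.mem_range.1 hl).trans_le hk
  simp [outcomeWeight, h _ this]

/-- A vector, extended by zero. -/
def extendZero {D : ℕ} (r : Fin D → ℝ) (i : ℕ) : ℝ := if h : i < D then r ⟨i, h⟩ else 0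

section qrff
variable {d : ℕ} (env : Env d) (m : ℕ) (x : E d)

/-- Summarizes the run for the probabilistic analysis: the circuit is determined by the interval of
accumulated weights that contains the first uniform number. The factor `g` is written to array 1
last, since it overwrites a feature. -/
lemma exec_prepareState :
    let s := finalState storeSamples prepareState m env x
    let n := numQubits (2 * m)
    let z := extendZero (rffMap m env.ω x)
    let g := rffNorm m env.ω x
    s.nsamp = m ∧ s.nqubit = n ∧ s.mem 1 0 = g ∧
      ∀ k < 2 * m * 2 ^ n, accWeight n z g k < env.u 0 → (env.u 0 : ℝ) ≤ accWeight n z g (k + 1) →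
        s.gates = eigGates n (k / 2 ^ n + 1) (k % 2 ^ n) := by
  intro s n z g
  set s₀ := (buildState storeSamples m env).storeVec 0 0 x with hs₀
  obtain ⟨h0, h1, hs, hr, hq, hgt, hω, hx⟩ := loadedState_spec env m x
  rw [← hs₀] at h0 h1 hs hr hq hgt hω hx
  set s₁ := exec env computeFeatures s₀ with hs₁
  set s₂ := exec env computeNorm s₁ with hs₂
  set s₃ := exec env allocQubits s₂ with hs₃
  have f1 : ∀ i : Fin (2 * m), s₁.mem 1 i = rffMap m env.ω x i :=
    exec_computeFeatures env h0 h1 hω hx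
  have r1 : s₁.reg 1 = m := (exec_reg env (by decide) _).trans h1
  have r2 : s₂.reg 1 = m := (exec_reg env (by decide) _).trans r1
  have r3 : s₃.reg 1 = m := (exec_reg env (by decide) _).trans r2
  have f2 : s₂.mem 1 = s₁.mem 1 := exec_mem env (by decide) _
  have f3 : s₃.mem 1 = s₁.mem 1 := (exec_mem env (by decide) _).trans f2
  have n1 : s₂.mem 4 0 = g := by
    rw [exec_computeNorm env s₁, r1, Finset.sum_range]
    simp only [f1]
    rfl
  have n2 : s₃.mem 4 0 = g := by rw [hs₃, exec_mem env (by decide)]; exact n1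
  have q2 : s₂.nqubit = 0 := by
    rw [hs₂, exec_nqubit env (by decide), hs₁, exec_nqubit env (by decide), hq]
  have t3 : s₃.nrand = 0 := by
    rw [hs₃, exec_nrand env (by decide), hs₂, exec_nrand env (by decide), hs₁,
      exec_nrand env (by decide), hr]
  have g3 : s₃.gates = [] := by
    rw [hs₃, exec_gates env (by decide), hs₂, exec_gates env (by decide), hs₁,
      exec_gates env (by decide), hgt]
  obtain ⟨a1, a2, a3⟩ := exec_allocQubits env r2 q2
  rw [← hs₃] at a1 a2 a3
  set s₄ := exec env (.rand 5 (.const 0)) s₃ with hs₄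
  set s₅ := exec env chooseOutcome s₄ with hs₅
  set s₆ := exec env applyGates s₅ with hs₆
  have hfinal : s = exec env (.setMem 1 (.const 0) (.mem 4 (.const 0))) s₆ := rfl
  have hg6 : s₆.mem 4 0 = g := by
    rw [hs₆, exec_mem env (by decide), hs₅, exec_mem env (by decide), hs₄,
      exec_mem env (by decide), n2]
  have hq5 : s₅.nqubit = n := by
    rw [hs₅, exec_nqubit env (by decide), hs₄, exec_nqubit env (by decide), a1]
  refine ⟨?_, ?_, ?_, ?_⟩
  · exact (exec_nsamp env (c := prepareState) (by decide) _).trans hs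
  · rw [hfinal, exec_nqubit env (by decide), hs₆, exec_nqubit env (by decide), hq5]
  · rw [hfinal]
    simp [exec, RExp.eval, NExp.eval, hg6]
  · intro k hk hk1 hk2
    have hg0 : 0 ≤ g := by
      simp only [g, rffNorm, norm1]
      exact Finset.sum_nonneg fun i _ => abs_nonneg _
    have hz : ∀ i < 2 * m, s₃.mem 1 i = z i := by
      intro i hi
      rw [f3]
      simp only [z, extendZero, hi, dite_true]
      exact f1 ⟨i, hi⟩
    have hsel := exec_chooseOutcome env (s := s₄) (n := n) (u := env.u 0) (z := s₃.mem 1) (g := g)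
      (m := m) (k := k) (accWeight_mono _ _ hg0) ?_ ?_ ?_ ?_ ?_ ?_ hk ?_ ?_
    · rw [hfinal, exec_gates env (by decide), hs₆, exec_applyGates env, hq5, hsel.1, hsel.2]
      · rw [hq5, hs₅, exec_reg env (by decide), hs₄, exec_reg env (by decide), a2]
      · rw [hs₅, exec_gates env (by decide), hs₄, exec_gates env (by decide), g3]
    · rw [hs₄, exec_reg env (by decide), r3]
    · rw [hs₄, exec_reg env (by decide), a2]
    · rw [hs₄, exec_reg env (by decide), a3]
    · rw [hs₄, exec_mem env (by decide)]
    · rw [hs₄, exec_mem env (by decide), n2]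
    · simp [hs₄, exec, NExp.eval, t3]
    · rwa [accWeight_congr hz g hk.le]
    · rwa [accWeight_congr hz g hk]

end qrff
/-! ## Eigenvectors of Pauli operators -/

/-- Eigenvector number `β` of the Pauli matrix `a` (with the computational basis for the
identity). -/
def eigVec (a β : ℕ) : Fin 2 → ℂ :=
  if a = 1 then (((√2)⁻¹ : ℝ) : ℂ) • ![1, (-1) ^ β]
  else if a = 2 then (((√2)⁻¹ : ℝ) : ℂ) • ![1, Complex.I * (-1) ^ β]
  else if β = 0 then ![1, 0] else ![0, 1]

/-- Eigenvector number `b` of the Pauli operator `i`. -/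
def eigState (n i b : ℕ) (p : Fin n → Fin 2) : ℂ :=
  ∏ j : Fin n, eigVec (i / 4 ^ (j : ℕ) % 4) (b / 2 ^ (j : ℕ) % 2) (p j)

lemma inv_sqrt_two_mul_self : (((√2)⁻¹ : ℝ) : ℂ) * (((√2)⁻¹ : ℝ) : ℂ) = 1 / 2 := by
  rw [← Complex.ofReal_mul, ← mul_inv, Real.mul_self_sqrt (by norm_num)]
  norm_num

/-- The two vectors form an orthonormal basis: the `X` basis, the `Y` basis, or the computational
basis for every other `a`. -/
lemma eigVec_resolution (a : ℕ) (p q : Fin 2) :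
    ∑ β : Fin 2, eigVec a β p * starRingEnd ℂ (eigVec a β q) = (1 : Matrix (Fin 2) (Fin 2) ℂ) p q := by
  have h := inv_sqrt_two_mul_self
  by_cases h1 : a = 1
  · subst h1
    fin_cases p <;> fin_cases q <;> simp [eigVec, Fin.sum_univ_two] at h ⊢ <;> grind
  · by_cases h2 : a = 2
    · subst h2
      have hI := Complex.I_mul_I
      fin_cases p <;> fin_cases q <;> simp [eigVec, Fin.sum_univ_two] at h ⊢ <;> grind
    · fin_cases p <;> fin_cases q <;> simp [eigVec, Fin.sum_univ_two, h1, h2]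

lemma eigVec_spectral (a : ℕ) (p q : Fin 2) :
    ∑ β : Fin 2, ((digitSign (a % 4) β : ℝ) : ℂ) *
      (eigVec (a % 4) β p * starRingEnd ℂ (eigVec (a % 4) β q)) = pauli (Fin.ofNat 4 a) p q := by
  have h := inv_sqrt_two_mul_self
  have hI := Complex.I_mul_I
  have ha : a % 4 < 4 := Nat.mod_lt _ (by norm_num)
  have e : Fin.ofNat 4 a = ⟨a % 4, ha⟩ := rfl
  rw [e]
  generalize a % 4 = k at *
  interval_cases k <;> fin_cases p <;> fin_cases q <;>
    simp [eigVec, Fin.sum_univ_two, pauli, digitSign] at h ⊢ <;> grind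

/-- Distributivity, with bit strings encoded as numbers below `2 ^ n`. It lifts the one-qubit
resolution and spectral identities to `n` qubits. -/
lemma sum_range_prod_digits {R : Type*} [CommSemiring R] (n : ℕ) (f : Fin n → ℕ → R) :
    ∑ b ∈ Finset.range (2 ^ n), ∏ j : Fin n, f j (b / 2 ^ (j : ℕ) % 2) =
      ∏ j : Fin n, ∑ β : Fin 2, f j β := by
  rw [Finset.sum_range, Finset.prod_univ_sum, Fintype.piFinset_univ,
    ← Equiv.sum_comp (finFunctionFinEquiv (m := 2) (n := n)).symm]
  rfl

lemma eigState_resolution (n i : ℕ) (p q : Fin n → Fin 2) :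
    ∑ b ∈ Finset.range (2 ^ n), eigState n i b p * starRingEnd ℂ (eigState n i b q) =
      (1 : QOp n) p q := by
  simp only [eigState, map_prod, ← Finset.prod_mul_distrib]
  rw [sum_range_prod_digits n fun j β =>
    eigVec (i / 4 ^ (j : ℕ) % 4) β (p j) * starRingEnd ℂ (eigVec (i / 4 ^ (j : ℕ) % 4) β (q j))]
  simp only [eigVec_resolution, Matrix.one_apply]
  rw [Finset.prod_ite_zero]
  simp [funext_iff]

lemma eigState_spectral (n i : ℕ) (p q : Fin n → Fin 2) :
    ∑ b ∈ Finset.range (2 ^ n), ((eigSign n i b : ℝ) : ℂ) *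
      (eigState n i b p * starRingEnd ℂ (eigState n i b q)) = pauliOp n i p q := by
  simp only [eigState, eigSign, Finset.prod_range, Complex.ofReal_prod, map_prod,
    ← Finset.prod_mul_distrib]
  rw [sum_range_prod_digits n fun j β => ((digitSign (i / 4 ^ (j : ℕ) % 4) β : ℝ) : ℂ) *
    (eigVec (i / 4 ^ (j : ℕ) % 4) β (p j) * starRingEnd ℂ (eigVec (i / 4 ^ (j : ℕ) % 4) β (q j)))]
  simp only [eigVec_spectral]
  rfl

/-! ## Circuits preparing eigenvectors -/

/-- The product of one-qubit state vectors. -/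
def prodState {n : ℕ} (φ : ℕ → Fin 2 → ℂ) (b : Fin n → Fin 2) : ℂ := ∏ j : Fin n, φ j (b j)

/-- The other factors are constant in the sum over the value of bit `j` and can be pulled out, so a
one-qubit gate acts on its own factor. No CNOT is needed, and the state remains a product
throughout. -/
lemma applyOne_prodState {n : ℕ} (U : Matrix (Fin 2) (Fin 2) ℂ) {j : ℕ} (h : j < n)
    (φ : ℕ → Fin 2 → ℂ) :
    applyOne U j (prodState (n := n) φ) = prodState (Function.update φ j (U.mulVec (φ j))) := by
  ext b
  simp only [applyOne, h, dite_true, prodState]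
  have e (ψ : ℕ → Fin 2 → ℂ) (c : Fin n → Fin 2) :=
    Fintype.prod_eq_mul_prod_compl (⟨j, h⟩ : Fin n) (fun k : Fin n => ψ k (c k))
  simp only [e]
  have e1 : ∏ k ∈ {(⟨j, h⟩ : Fin n)}ᶜ, Function.update φ j (U.mulVec (φ j)) (k : ℕ) (b k) =
      ∏ k ∈ {(⟨j, h⟩ : Fin n)}ᶜ, φ k (b k) := by
    refine Finset.prod_congr rfl fun k hk => ?_
    rw [Function.update_of_ne]
    rintro rfl
    simp at hk
  have e2 (c : Fin 2) : ∏ k ∈ {(⟨j, h⟩ : Fin n)}ᶜ, φ k (Function.update b ⟨j, h⟩ c k) =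
      ∏ k ∈ {(⟨j, h⟩ : Fin n)}ᶜ, φ k (b k) := by
    refine Finset.prod_congr rfl fun k hk => ?_
    rw [Function.update_of_ne]
    simpa using hk
  simp only [e1, e2, Function.update_self, Matrix.mulVec, dotProduct, Finset.sum_mul, mul_assoc]

lemma foldl_qubitGates {n : ℕ} {j : ℕ} (h : j < n) (φ : ℕ → Fin 2 → ℂ) (hφ : φ j = ![1, 0])
    {a β : ℕ} (ha : a < 4) (hβ : β < 2) :
    (qubitGates j a β).foldl (fun ψ G => G.apply ψ) (prodState (n := n) φ) =
      prodState (Function.update φ j (eigVec a β)) := by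
  have hX : (!![0, 1; 1, 0] : Matrix (Fin 2) (Fin 2) ℂ).mulVec ![1, 0] = ![0, 1] := by
    ext i; fin_cases i <;> simp [Matrix.mulVec, dotProduct, Fin.sum_univ_two]
  have hH (c : ℂ) : (c • (!![1, 1; 1, -1] : Matrix (Fin 2) (Fin 2) ℂ)).mulVec ![1, 0] =
      c • ![1, 1] := by
    ext i; fin_cases i <;> simp [Matrix.mulVec, dotProduct, Fin.sum_univ_two]
  have hH' (c : ℂ) : (c • (!![1, 1; 1, -1] : Matrix (Fin 2) (Fin 2) ℂ)).mulVec ![0, 1] =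
      c • ![1, -1] := by
    ext i; fin_cases i <;> simp [Matrix.mulVec, dotProduct, Fin.sum_univ_two]
  have hS (c v : ℂ) : (!![1, 0; 0, Complex.I] : Matrix (Fin 2) (Fin 2) ℂ).mulVec (c • ![1, v]) =
      c • ![1, Complex.I * v] := by
    ext i; fin_cases i <;> simp [Matrix.mulVec, dotProduct, Fin.sum_univ_two]; ring
  have hself : Function.update φ j ![1, 0] = φ := by rw [← hφ, Function.update_eq_self]
  interval_cases β <;> interval_cases a <;>
    -- These simp lemmas are disabled so that the matrix-vector products keep the form matched by
    -- `hX`, `hH`, `hH'` and `hS`.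
    simp [-Matrix.smul_cons, -Matrix.smul_of, -Matrix.cons_mulVec,
      qubitGates, Gate.apply, applyOne_prodState _ h, hφ, hX, hH, hH', hS, hself, eigVec]

lemma circuitState_eigGates (n i b : ℕ) : circuitState n (eigGates n i b) = eigState n i b := by
  have key : ∀ k ≤ n, (eigGates k i b).foldl (fun ψ G => G.apply ψ)
      (prodState (n := n) fun _ => ![1, 0]) = prodState (n := n) fun j =>
        if j < k then eigVec (i / 4 ^ j % 4) (b / 2 ^ j % 2) else ![1, 0] := by
    intro k
    induction k with
    | zero => intro _; simp [eigGates]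
    | succ k ih =>
      intro hk
      have e : eigGates (k + 1) i b =
          eigGates k i b ++ qubitGates k (i / 4 ^ k % 4) (b / 2 ^ k % 2) := by
        simp [eigGates, List.range_succ]
      rw [e, List.foldl_append, ih (by omega), foldl_qubitGates (by omega) _ (by simp)
        (Nat.mod_lt _ (by norm_num)) (Nat.mod_lt _ (by norm_num))]
      congr 1
      ext j : 1
      rcases lt_trichotomy j k with h | rfl | h
      · rw [Function.update_of_ne h.ne, if_pos h, if_pos (by omega)]
      · simp
      · rw [Function.update_of_ne h.ne', if_neg (by omega), if_neg (by omega)]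
  have h0 : (fun b : Fin n → Fin 2 => if b = 0 then (1 : ℂ) else 0) =
      prodState fun _ => ![1, 0] := by
    ext b
    have (β : Fin 2) : (![1, 0] : Fin 2 → ℂ) β = if β = 0 then 1 else 0 := by
      fin_cases β <;> simp
    simp only [prodState, this, Finset.prod_ite_zero]
    simp [funext_iff]
  rw [circuitState, h0, key n le_rfl]
  ext p
  simp [prodState, eigState]

/-! ## Pauli operators and the classical-to-quantum embedding -/

lemma pauliOp_zero (n : ℕ) : pauliOp n 0 = 1 := by
  ext b c
  simp only [pauliOp, Matrix.of_apply, Nat.zero_div]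
  have : pauli (Fin.ofNat 4 0) = 1 := rfl
  simp only [this, Matrix.one_apply]
  rw [Finset.prod_ite_zero]
  simp [funext_iff]

lemma trace_pauli_mul_pauli (a b : Fin 4) :
    (pauli a * pauli b).trace = if a = b then 2 else 0 := by
  fin_cases a <;> fin_cases b <;> simp [pauli, Matrix.trace_fin_two] <;> norm_num

/-- The trace of a tensor product is the product of the traces, which reduces orthogonality to one
qubit. The bounds on `i` and `j` make the base-4 digits determine the index. -/
lemma trace_pauliOp_mul_pauliOp {n i j : ℕ} (hi : i < 4 ^ n) (hj : j < 4 ^ n) :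
    (pauliOp n i * pauliOp n j).trace = if i = j then 2 ^ n else 0 := by
  have e : (pauliOp n i * pauliOp n j).trace =
      ∏ k : Fin n, (pauli (Fin.ofNat 4 (i / 4 ^ (k : ℕ))) *
        pauli (Fin.ofNat 4 (j / 4 ^ (k : ℕ)))).trace := by
    simp only [Matrix.trace, Matrix.diag_apply, Matrix.mul_apply, Finset.prod_univ_sum,
      Fintype.piFinset_univ, pauliOp, Matrix.of_apply, ← Finset.prod_mul_distrib]
  rw [e]
  simp only [trace_pauli_mul_pauli]
  rw [Finset.prod_ite_zero]
  by_cases hij : i = j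
  · simp [hij]
  · rw [if_neg, if_neg hij]
    intro h
    apply hij
    have : (finFunctionFinEquiv (m := 4) (n := n)).symm ⟨i, hi⟩ =
        (finFunctionFinEquiv (m := 4) (n := n)).symm ⟨j, hj⟩ := by
      ext k
      simpa [Fin.ofNat, Fin.ext_iff] using congrArg Fin.val (h k (Finset.mem_univ _))
    simpa using this

lemma trace_pauliOp {n i : ℕ} (hi : i < 4 ^ n) (h0 : i ≠ 0) : (pauliOp n i).trace = 0 := by
  have := trace_pauliOp_mul_pauliOp hi (show 0 < 4 ^ n by positivity)
  rwa [pauliOp_zero, mul_one, if_neg h0] at this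

lemma lt_four_pow_numQubits (D : ℕ) : D < 4 ^ numQubits D :=
  Nat.le_pow_clog (by norm_num) (D + 1)

section embedding
variable {D : ℕ} (r : Fin D → ℝ)

/-- The padding contributes nothing, and `|rᵢ| sign(rᵢ) = rᵢ` removes the signs. Indices are shifted
to start at 0. -/
lemma c2qe_eq_sum : c2qe r = ∑ i ∈ Finset.range D, ((2 : ℂ) ^ numQubits D)⁻¹ •
    (((|extendZero r i| : ℝ) : ℂ) • (1 : QOp (numQubits D)) +
      ((extendZero r i : ℝ) : ℂ) • pauliOp (numQubits D) (i + 1)) := by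
  have hD := lt_four_pow_numQubits D
  rw [c2qe, ← Finset.sum_subset (s₁ := Finset.Icc 1 D)]
  · rw [Finset.range_eq_Ico, show Finset.Icc 1 D = Finset.Ico (0 + 1) (D + 1) by simp; rfl,
      ← Finset.sum_Ico_add']
    refine Finset.sum_congr rfl fun i hi => ?_
    have hi' := Finset.mem_Ico.1 hi
    have e : padded r (i + 1) = extendZero r i := by
      simp [padded, extendZero, hi']
    have hs : |extendZero r i| * Real.sign (extendZero r i) = extendZero r i := by
      rcases lt_trichotomy (extendZero r i) 0 with h | h | h
      · rw [Real.sign_of_neg h, abs_of_neg h]; ring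
      · simp [h]
      · rw [Real.sign_of_pos h, abs_of_pos h, mul_one]
    rw [e, smul_comm, smul_add, smul_smul, ← Complex.ofReal_mul, hs]
  · exact Finset.Icc_subset_Icc_right (by omega)
  · intro i _ hi
    have : padded r i = 0 := by
      rw [padded, dif_neg]
      simpa using hi
    simp [this]

lemma sum_abs_extendZero : ∑ i ∈ Finset.range D, |extendZero r i| = norm1 r := by
  rw [Finset.sum_range, norm1]
  simp [extendZero]

lemma c2qe_eq {r : Fin D → ℝ} (h : norm1 r = 1) : c2qe r = ((2 : ℂ) ^ numQubits D)⁻¹ •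
    (1 + ∑ i ∈ Finset.range D, ((extendZero r i : ℝ) : ℂ) • pauliOp (numQubits D) (i + 1)) := by
  rw [c2qe_eq_sum, ← Finset.smul_sum, Finset.sum_add_distrib, ← Finset.sum_smul,
    ← Complex.ofReal_sum, sum_abs_extendZero, h, Complex.ofReal_one, one_smul]

/-- In the product of the two Pauli expansions the cross terms with the identity are traceless, the
identity term gives the 1 that is subtracted, and orthogonality leaves the diagonal of the double
sum. -/
lemma trace_c2qe_mul_c2qe {r r' : Fin D → ℝ} (h : norm1 r = 1) (h' : norm1 r' = 1) :
    2 ^ numQubits D * (c2qe r * c2qe r').trace - 1 = ((∑ i, r i * r' i : ℝ) : ℂ) := by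
  have hD := lt_four_pow_numQubits D
  set n := numQubits D with hn
  have hlt : ∀ i ∈ Finset.range D, i + 1 < 4 ^ n := fun i hi => by
    have := Finset.mem_range.1 hi
    omega
  have e1 (s : Fin D → ℝ) : (∑ i ∈ Finset.range D, ((extendZero s i : ℝ) : ℂ) •
      pauliOp n (i + 1)).trace = 0 := by
    rw [Matrix.trace_sum]
    refine Finset.sum_eq_zero fun i hi => ?_
    rw [Matrix.trace_smul, trace_pauliOp (hlt i hi) (by omega), smul_zero]
  have e2 : ((∑ i ∈ Finset.range D, ((extendZero r i : ℝ) : ℂ) • pauliOp n (i + 1)) *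
      ∑ i ∈ Finset.range D, ((extendZero r' i : ℝ) : ℂ) • pauliOp n (i + 1)).trace =
        2 ^ n * ((∑ i, r i * r' i : ℝ) : ℂ) := by
    rw [Finset.sum_mul, Matrix.trace_sum]
    have : ∀ i ∈ Finset.range D, ((((extendZero r i : ℝ) : ℂ) • pauliOp n (i + 1)) *
        ∑ i ∈ Finset.range D, ((extendZero r' i : ℝ) : ℂ) • pauliOp n (i + 1)).trace =
          2 ^ n * ((extendZero r i * extendZero r' i : ℝ) : ℂ) := by
      intro i hi
      rw [Finset.mul_sum, Matrix.trace_sum, Finset.sum_eq_single_of_mem i hi]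
      · rw [smul_mul_smul_comm, Matrix.trace_smul, trace_pauliOp_mul_pauliOp (hlt i hi) (hlt i hi)]
        simp [mul_comm]
      · intro j hj hij
        rw [smul_mul_smul_comm, Matrix.trace_smul, trace_pauliOp_mul_pauliOp (hlt i hi) (hlt j hj),
          if_neg (by omega), smul_zero]
    rw [Finset.sum_congr rfl this, ← Finset.mul_sum, ← Complex.ofReal_sum, Finset.sum_range]
    simp [extendZero]
  have hcard : (1 : QOp n).trace = 2 ^ n := by
    simp [Matrix.trace_one]
  rw [c2qe_eq h, c2qe_eq h', smul_mul_smul_comm, Matrix.trace_smul, add_mul, mul_add, mul_add,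
    one_mul, one_mul, mul_one, Matrix.trace_add, Matrix.trace_add, Matrix.trace_add, e1, e1, e2,
    hcard]
  have : (2 : ℂ) ^ n ≠ 0 := by positivity
  rw [smul_eq_mul]
  field_simp
  ring

/-- The embedding of a normalized vector as a mixture of eigenvectors of Pauli operators. -/
lemma c2qe_apply_eq_sum_outcomeWeight {z : Fin D → ℝ} {g : ℝ} (hg : 0 < g)
    (p q : Fin (numQubits D) → Fin 2) :
    c2qe (fun i => z i / g) p q = ∑ i ∈ Finset.range D, ∑ b ∈ Finset.range (2 ^ numQubits D),
      ((outcomeWeight (numQubits D) (extendZero z) g i b : ℝ) : ℂ) *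
        (eigState (numQubits D) (i + 1) b p *
          starRingEnd ℂ (eigState (numQubits D) (i + 1) b q)) := by
  rw [c2qe_eq_sum, Matrix.sum_apply]
  refine Finset.sum_congr rfl fun i _ => ?_
  generalize numQubits D = n at *
  have hz : extendZero (fun i => z i / g) i = extendZero z i / g := by
    simp only [extendZero]; split <;> simp
  -- The weight is affine in the eigenvalue: the constant part is summed by the resolution of the
  -- identity, the linear part by the spectral decomposition.
  have hw (b : ℕ) : ((outcomeWeight n (extendZero z) g i b : ℝ) : ℂ) =
      (|extendZero z i| / (g * 2 ^ n) : ℝ) +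
        (extendZero z i / (g * 2 ^ n) : ℝ) * ((eigSign n (i + 1) b : ℝ) : ℂ) := by
    rw [← Complex.ofReal_mul, ← Complex.ofReal_add, outcomeWeight, Real.sqrt_mul_self_eq_abs]
    congr 1
    push_cast
    ring
  simp only [hw, add_mul, Finset.sum_add_distrib]
  simp only [mul_assoc, ← Finset.mul_sum]
  rw [eigState_resolution, eigState_spectral, hz, abs_div, abs_of_pos hg]
  simp only [Matrix.smul_apply, Matrix.add_apply, smul_eq_mul]
  push_cast
  field_simp

end embedding
/-! ## The feature map and its quantum version -/

lemma sum_range_two_mul {M : Type*} [AddCommMonoid M] (f : ℕ → M) (m : ℕ) :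
    ∑ i ∈ Finset.range (2 * m), f i = ∑ j ∈ Finset.range m, (f (2 * j) + f (2 * j + 1)) := by
  induction m with
  | zero => simp
  | succ m ih =>
    rw [show 2 * (m + 1) = 2 * m + 1 + 1 by ring, Finset.sum_range_succ, Finset.sum_range_succ, ih,
      Finset.sum_range_succ, add_assoc]

lemma sum_range_mul_div_mod {M : Type*} [AddCommMonoid M] (f : ℕ → ℕ → M) (D : ℕ) {q : ℕ}
    (hq : 0 < q) :
    ∑ k ∈ Finset.range (D * q), f (k / q) (k % q) =
      ∑ i ∈ Finset.range D, ∑ b ∈ Finset.range q, f i b := by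
  induction D with
  | zero => simp
  | succ D ih =>
    rw [add_mul, one_mul, Finset.sum_range_add, ih, Finset.sum_range_succ]
    congr 1
    refine Finset.sum_congr rfl fun b hb => ?_
    have hb' := Finset.mem_range.1 hb
    rw [mul_comm, Nat.mul_add_div hq, Nat.div_eq_of_lt hb', Nat.mul_add_mod, Nat.mod_eq_of_lt hb',
      add_zero]

section features
variable {d m : ℕ} (ω : ℕ → E d) (x x' : E d)

/-- The addition formula for the cosine, applied to each cosine–sine pair. -/
lemma sum_rffMap_mul_rffMap (hm : 1 ≤ m) :
    ∑ i, rffMap m ω x i * rffMap m ω x' i =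
      (∑ j ∈ Finset.range m, Real.cos (inner ℝ (ω j) (x - x'))) / m := by
  have hm' : (m : ℝ) ≠ 0 := by positivity
  set c := √(2 / ((2 * m : ℕ) : ℝ)) with hc
  have hcc : c * c = 1 / m := by
    rw [hc, Real.mul_self_sqrt (by positivity)]
    push_cast
    field_simp
  have h := Finset.sum_range (n := 2 * m) fun i =>
    (c * (if i % 2 = 0 then Real.cos (inner ℝ (ω (i / 2)) x)
      else Real.sin (inner ℝ (ω (i / 2)) x))) *
    (c * (if i % 2 = 0 then Real.cos (inner ℝ (ω (i / 2)) x')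
      else Real.sin (inner ℝ (ω (i / 2)) x')))
  simp only [rffMap]
  rw [← hc, ← h, sum_range_two_mul, Finset.sum_div]
  refine Finset.sum_congr rfl fun j _ => ?_
  have e1 : (2 * j + 1) % 2 = 1 := by omega
  have e2 : (2 * j + 1) / 2 = j := by omega
  rw [inner_sub_right, Real.cos_sub]
  simp only [Nat.mul_mod_right, e1, e2, Nat.mul_div_cancel_left _ (show 0 < 2 by norm_num),
    if_true, one_ne_zero, if_false]
  linear_combination (Real.cos (inner ℝ (ω j) x) * Real.cos (inner ℝ (ω j) x') +
    Real.sin (inner ℝ (ω j) x) * Real.sin (inner ℝ (ω j) x')) * hcc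

/-- The squared Euclidean norm of `z(x)` is an average of `cos 0 = 1`, so `z(x)` is never zero. -/
lemma rffNorm_pos (hm : 1 ≤ m) : 0 < rffNorm m ω x := by
  refine lt_of_le_of_ne (by unfold rffNorm norm1; positivity) fun h => ?_
  have h0 := (Finset.sum_eq_zero_iff_of_nonneg fun i _ => abs_nonneg (rffMap m ω x i)).1
    (show ∑ i, |rffMap m ω x i| = 0 from h.symm)
  have h1 := sum_rffMap_mul_rffMap ω x x hm
  have hm' : (m : ℝ) ≠ 0 := by positivity
  rw [Finset.sum_eq_zero fun i hi => by rw [abs_eq_zero.1 (h0 i hi), zero_mul]] at h1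
  simp [hm'] at h1

lemma norm1_normalized (hm : 1 ≤ m) : norm1 (fun i => rffMap m ω x i / rffNorm m ω x) = 1 := by
  have hg := rffNorm_pos ω x hm
  simp only [norm1, abs_div, abs_of_pos hg, ← Finset.sum_div]
  exact div_self hg.ne'

/-- The quantum kernel of QRFF, corrected by the norms, is the kernel of RFF. -/
lemma eqk_qrffState (hm : 1 ≤ m) :
    (rffNorm m ω x * rffNorm m ω x' : ℂ) *
        (2 ^ numQubits (2 * m) * eqk (qrffState m ω) x x' - 1) =
      ((∑ i, rffMap m ω x i * rffMap m ω x' i : ℝ) : ℂ) := by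
  have hg := (rffNorm_pos ω x hm).ne'
  have hg' := (rffNorm_pos ω x' hm).ne'
  rw [eqk, qrffState, qrffState,
    trace_c2qe_mul_c2qe (norm1_normalized ω x hm) (norm1_normalized ω x' hm),
    ← Complex.ofReal_mul, ← Complex.ofReal_mul, Finset.mul_sum]
  congr 1
  refine Finset.sum_congr rfl fun i _ => ?_
  field_simp

lemma qrffState_apply (hm : 1 ≤ m) (p q : Fin (numQubits (2 * m)) → Fin 2) :
    let n := numQubits (2 * m)
    let w := outcomeWeight n (extendZero (rffMap m ω x)) (rffNorm m ω x)
    qrffState m ω x p q = ∑ i ∈ Finset.range (2 * m), ∑ b ∈ Finset.range (2 ^ n),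
      ((w i b : ℝ) : ℂ) * (eigState n (i + 1) b p * starRingEnd ℂ (eigState n (i + 1) b q)) :=
  c2qe_apply_eq_sum_outcomeWeight (rffNorm_pos ω x hm) p q

/-- Positivity is visible in the mixture of pure states; the trace is visible in the Pauli
expansion. -/
lemma isDensity_qrffState (hm : 1 ≤ m) : IsDensity (qrffState m ω x) := by
  constructor
  · have e : qrffState m ω x = ∑ i ∈ Finset.range (2 * m),
        ∑ b ∈ Finset.range (2 ^ numQubits (2 * m)),
        ((outcomeWeight (numQubits (2 * m)) (extendZero (rffMap m ω x)) (rffNorm m ω x) i b : ℝ) :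
          ℂ) • Matrix.vecMulVec (eigState (numQubits (2 * m)) (i + 1) b)
            (star (eigState (numQubits (2 * m)) (i + 1) b)) := by
      ext p q
      rw [qrffState_apply ω x hm p q]
      simp [Matrix.sum_apply, Matrix.vecMulVec_apply]
    rw [e]
    refine Matrix.posSemidef_sum _ fun i _ => Matrix.posSemidef_sum _ fun b _ => ?_
    refine (Matrix.posSemidef_vecMulVec_self_star _).smul ?_
    exact Complex.zero_le_real.2 (outcomeWeight_nonneg _ _ (rffNorm_pos ω x hm).le _ _)
  · have hD := lt_four_pow_numQubits (2 * m)
    rw [qrffState, c2qe_eq (norm1_normalized ω x hm), Matrix.trace_smul, Matrix.trace_add,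
      Matrix.trace_sum, Finset.sum_eq_zero, Matrix.trace_one]
    · simp
    · intro i hi
      have := Finset.mem_range.1 hi
      rw [Matrix.trace_smul, trace_pauliOp (by omega) (by omega), smul_zero]

end features

/-! ## The prepared state -/

section prepared

/-- The uniform measure on the sequences of random numbers. -/
abbrev uniformLaw : Measure (ℕ → unitInterval) :=
  Measure.infinitePi fun _ : ℕ => (volume : Measure unitInterval)

lemma integral_indicator_Ioc_uniform {a b : ℝ} (ha : 0 ≤ a) (hab : a ≤ b) (hb : b ≤ 1) :
    ∫ u, (Set.Ioc a b).indicator (fun _ => (1 : ℂ)) (u 0 : ℝ) ∂uniformLaw = ((b - a : ℝ) : ℂ) := by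
  have hmp := measurePreserving_eval_infinitePi (fun _ : ℕ => (volume : Measure unitInterval)) 0
  set S : Set unitInterval := Set.Ioc ⟨a, ha, hab.trans hb⟩ ⟨b, ha.trans hab, hb⟩ with hS
  have e : (fun u : ℕ → unitInterval => (Set.Ioc a b).indicator (fun _ => (1 : ℂ)) (u 0 : ℝ)) =
      ((fun u : ℕ → unitInterval => u 0) ⁻¹' S).indicator fun _ => (1 : ℂ) := by
    ext u
    rfl
  rw [e, integral_indicator (hmp.measurable measurableSet_Ioc), setIntegral_const,
    measureReal_def]
  erw [hmp.measure_preimage measurableSet_Ioc.nullMeasurableSet]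
  rw [unitInterval.volume_Ioc, ENNReal.toReal_ofReal (by simpa using hab)]
  simp

lemma integrable_indicator_Ioc_uniform (a b : ℝ) :
    Integrable (fun u : ℕ → unitInterval => (Set.Ioc a b).indicator (fun _ => (1 : ℂ)) (u 0 : ℝ))
      uniformLaw := by
  have hm : MeasurableSet {u : ℕ → unitInterval | (u 0 : ℝ) ∈ Set.Ioc a b} :=
    (measurable_subtype_coe.comp (measurable_pi_apply 0)) measurableSet_Ioc
  exact (integrable_const (1 : ℂ)).indicator hm

/-- The value 0 lies in none of the half-open intervals used for selection; this removes it as a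
null event. -/
lemma ae_uniform_pos : ∀ᵐ u ∂uniformLaw, 0 < (u 0 : ℝ) := by
  have hmp := measurePreserving_eval_infinitePi (fun _ : ℕ => (volume : Measure unitInterval)) 0
  have h0 : ∀ᵐ v : unitInterval, v ≠ 0 := by
    rw [ae_iff]
    have : {a : unitInterval | ¬a ≠ 0} = {0} := by ext; simp
    rw [this]
    exact measure_singleton _
  filter_upwards [hmp.quasiMeasurePreserving.ae h0] with u hu
  exact lt_of_le_of_ne (u 0).2.1 fun h => hu (Subtype.ext h.symm)

/-- Each indicator is a difference of two threshold functions, so the sum telescopes. Intervals of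
length zero cause no trouble. -/
lemma sum_indicator_Ioc {W : ℕ → ℝ} (hW : Monotone W) (K : ℕ) {v : ℝ} (h0 : W 0 < v)
    (h1 : v ≤ W K) :
    ∑ k ∈ Finset.range K, (Set.Ioc (W k) (W (k + 1))).indicator (fun _ => (1 : ℂ)) v = 1 := by
  have e (k : ℕ) : (Set.Ioc (W k) (W (k + 1))).indicator (fun _ => (1 : ℂ)) v =
      (if v ≤ W (k + 1) then 1 else 0) - if v ≤ W k then 1 else 0 := by
    have := hW (Nat.le_succ k)
    simp only [Set.indicator_apply, Set.mem_Ioc]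
    by_cases h : v ≤ W k
    · simp [h, h.trans this, not_lt.2 h]
    · simp [h, not_le.1 h]
  simp only [e]
  rw [Finset.sum_range_sub fun k => if v ≤ W k then (1 : ℂ) else 0, if_pos h1,
    if_neg (not_le.2 h0), sub_zero]

/-- Integral of a function of the outcome selected by inverse transform sampling. -/
lemma integral_inverse_transform {W : ℕ → ℝ} (hW : Monotone W) {K : ℕ} (h0 : W 0 = 0)
    (h1 : W K = 1) {F : (ℕ → unitInterval) → ℂ} {f : ℕ → ℂ}
    (hF : ∀ u, ∀ k < K, W k < u 0 → (u 0 : ℝ) ≤ W (k + 1) → F u = f k) :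
    ∫ u, F u ∂uniformLaw = ∑ k ∈ Finset.range K, ((W (k + 1) - W k : ℝ) : ℂ) * f k := by
  have hae : F =ᵐ[uniformLaw] fun u => ∑ k ∈ Finset.range K,
      (Set.Ioc (W k) (W (k + 1))).indicator (fun _ => (1 : ℂ)) (u 0 : ℝ) * f k := by
    filter_upwards [ae_uniform_pos] with u hu
    calc F u = (∑ k ∈ Finset.range K,
          (Set.Ioc (W k) (W (k + 1))).indicator (fun _ => (1 : ℂ)) (u 0 : ℝ)) * F u := by
          rw [sum_indicator_Ioc hW K (by rwa [h0]) (by rw [h1]; exact (u 0).2.2), one_mul]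
      _ = _ := by
          rw [Finset.sum_mul]
          refine Finset.sum_congr rfl fun k hk => ?_
          by_cases h : (u 0 : ℝ) ∈ Set.Ioc (W k) (W (k + 1))
          · rw [hF u k (Finset.mem_range.1 hk) h.1 h.2]
          · simp [h]
  rw [integral_congr_ae hae, integral_finsetSum _ fun k _ =>
    (integrable_indicator_Ioc_uniform _ _).mul_const _]
  refine Finset.sum_congr rfl fun k hk => ?_
  rw [integral_mul_const, integral_indicator_Ioc_uniform]
  · rw [← h0]; exact hW (Nat.zero_le _)
  · exact hW (Nat.le_succ k)
  · rw [← h1]; exact hW (Finset.mem_range.1 hk)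

variable {d : ℕ}

/-- The total weight is the trace of the state, because each eigenvector in the mixture is a unit
vector. -/
lemma accWeight_total {m : ℕ} (hm : 1 ≤ m) (ω : ℕ → E d) (x : E d) :
    let n := numQubits (2 * m)
    accWeight n (extendZero (rffMap m ω x)) (rffNorm m ω x) (2 * m * 2 ^ n) = 1 := by
  intro n
  have h := (isDensity_qrffState ω x hm).2
  have e (i b : ℕ) : ∑ p : Fin n → Fin 2,
      eigState n i b p * starRingEnd ℂ (eigState n i b p) = 1 := by
    simp only [eigState, map_prod, ← Finset.prod_mul_distrib]
    have := Finset.prod_univ_sum (fun _ : Fin n => (Finset.univ : Finset (Fin 2))) fun j β =>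
      eigVec (i / 4 ^ (j : ℕ) % 4) (b / 2 ^ (j : ℕ) % 2) β *
        starRingEnd ℂ (eigVec (i / 4 ^ (j : ℕ) % 4) (b / 2 ^ (j : ℕ) % 2) β)
    rw [Fintype.piFinset_univ] at this
    rw [← this]
    refine Finset.prod_eq_one fun j _ => ?_
    have h2 := inv_sqrt_two_mul_self
    have hI := Complex.I_mul_I
    rcases Nat.mod_two_eq_zero_or_one (b / 2 ^ (j : ℕ)) with hb | hb <;> rw [hb] <;>
      simp only [eigVec] <;> split_ifs <;> simp [Fin.sum_univ_two] at h2 ⊢ <;> grind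
  have h' : ∑ i ∈ Finset.range (2 * m), ∑ b ∈ Finset.range (2 ^ n),
      ((outcomeWeight n (extendZero (rffMap m ω x)) (rffNorm m ω x) i b : ℝ) : ℂ) = 1 := by
    rw [← h]
    simp only [Matrix.trace, Matrix.diag_apply, qrffState_apply ω x hm]
    refine Eq.symm (Finset.sum_comm.trans (Finset.sum_congr rfl fun i _ => ?_))
    refine Finset.sum_comm.trans (Finset.sum_congr rfl fun b _ => ?_)
    rw [← Finset.mul_sum, e, mul_one]
  rw [accWeight, sum_range_mul_div_mod (fun i b => outcomeWeight n (extendZero (rffMap m ω x))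
    (rffNorm m ω x) i b) (2 * m) (q := 2 ^ n) (by positivity)]
  exact_mod_cast h'

lemma preparedState_eq {m : ℕ} (hm : 1 ≤ m) (t : ℕ) (ω : ℕ → E d) (x : E d) :
    preparedState storeSamples prepareState m (numQubits (2 * m)) t ω x = qrffState m ω x := by
  ext p q
  let n := numQubits (2 * m)
  set W := accWeight n (extendZero (rffMap m ω x)) (rffNorm m ω x) with hWdef
  have hW : Monotone W := accWeight_mono _ _ (rffNorm_pos ω x hm).le
  rw [preparedState, Matrix.of_apply]
  rw [integral_inverse_transform hW (K := 2 * m * 2 ^ n) (by simp [hWdef, accWeight])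
    (accWeight_total hm ω x) (f := fun k => eigState n (k / 2 ^ n + 1) (k % 2 ^ n) p *
      starRingEnd ℂ (eigState n (k / 2 ^ n + 1) (k % 2 ^ n) q))]
  · rw [qrffState_apply ω x hm p q]
    rw [← sum_range_mul_div_mod (fun i b => ((outcomeWeight n (extendZero (rffMap m ω x))
      (rffNorm m ω x) i b : ℝ) : ℂ) * (eigState n (i + 1) b p *
        starRingEnd ℂ (eigState n (i + 1) b q))) (2 * m) (q := 2 ^ n) (by positivity)]
    refine Finset.sum_congr rfl fun k _ => ?_
    simp only [hWdef, accWeight]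
    rw [Finset.sum_range_succ, add_sub_cancel_left]
  · intro u k hk h1 h2
    have h := (exec_prepareState ⟨t, ω, u⟩ m x).2.2.2 k hk h1 h2
    rw [h, circuitState_eigGates]

end prepared

lemma implementsQRFF : ImplementsQRFF storeSamples prepareState := by
  intro d m hm
  refine ⟨fun env => ⟨(loadedState_spec env m 0).2.2.1, fun x => ?_⟩, fun t ω x =>
    preparedState_eq hm t ω x⟩
  obtain ⟨h1, h2, h3, -⟩ := exec_prepareState env m x
  exact ⟨h1, h2, h3⟩
/-! ## Moments of the inverse Fourier transform -/

section moments
variable {d : ℕ} {p : Measure (E d)} [IsProbabilityMeasure p] {k : E d → E d → ℝ} {B : ℝ}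

lemma integrable_cos_inner (Δ : E d) : Integrable (fun w : E d => Real.cos (inner ℝ w Δ)) p := by
  refine Integrable.of_bound (C := 1) ?_ (ae_of_all _ fun w => ?_)
  · exact (by fun_prop : Continuous fun w : E d => Real.cos (inner ℝ w Δ)).aestronglyMeasurable
  · simpa using Real.abs_cos_le_one _

lemma IsInverseFT.integral_cos (h : IsInverseFT p k) (Δ : E d) :
    ∫ w, Real.cos (inner ℝ w Δ) ∂p = k Δ 0 := by
  have h1 := congrArg Complex.re (h Δ)
  rw [charFun_apply, ← RCLike.re_eq_complex_re, ← integral_re] at h1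
  · simpa [Complex.exp_ofReal_mul_I_re] using h1
  · refine Integrable.of_bound (C := 1) ?_ (ae_of_all _ fun w => ?_)
    · exact (by fun_prop : Continuous fun w : E d =>
        Complex.exp ((inner ℝ w Δ : ℝ) * Complex.I)).aestronglyMeasurable
    · rw [Complex.norm_exp_ofReal_mul_I]

lemma IsInverseFT.le_one (h : IsInverseFT p k) (Δ : E d) : k Δ 0 ≤ 1 := by
  rw [← h.integral_cos]
  calc ∫ w, Real.cos (inner ℝ w Δ) ∂p ≤ ∫ _, 1 ∂p :=
        integral_mono (integrable_cos_inner Δ) (integrable_const _) fun w => Real.cos_le_one _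
    _ = 1 := by simp

/-- A function with a local maximum at `0` whose second derivative there is bounded by `B` decays at
most quadratically. -/
lemma eventually_sub_le_of_deriv_deriv {φ : ℝ → ℝ} {B η : ℝ}
    (h1 : ∀ᶠ s in 𝓝 (0 : ℝ), DifferentiableAt ℝ φ s) (h2 : DifferentiableAt ℝ (deriv φ) 0)
    (h3 : |deriv (deriv φ) 0| ≤ B) (hmax : IsLocalMax φ 0) (hη : 0 < η) :
    ∀ᶠ r in 𝓝[>] (0 : ℝ), φ 0 - φ r ≤ (B + η) * r ^ 2 := by
  have hd0 : deriv φ 0 = 0 := hmax.deriv_eq_zero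
  have hB : 0 ≤ B + η := by linarith [abs_nonneg (deriv (deriv φ) 0)]
  have h4 : ∀ᶠ s in 𝓝 (0 : ℝ), |deriv φ s| ≤ (B + η) * |s| := by
    have := (hasDerivAt_iff_isLittleO.1 h2.hasDerivAt).def hη
    filter_upwards [this] with s hs
    simp only [hd0, sub_zero, smul_eq_mul, Real.norm_eq_abs] at hs
    calc |deriv φ s| = |(deriv φ s - s * deriv (deriv φ) 0) + s * deriv (deriv φ) 0| := by ring_nf
      _ ≤ η * |s| + |s| * B := by
        refine (abs_add_le _ _).trans (add_le_add hs ?_)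
        rw [abs_mul]
        gcongr
      _ = (B + η) * |s| := by ring
  obtain ⟨ρ, hρ, hball⟩ := Metric.eventually_nhds_iff.1 (h1.and h4)
  filter_upwards [Ioo_mem_nhdsGT hρ] with r hr
  have hin : ∀ s ∈ Set.Icc 0 r, dist s 0 < ρ := fun s hs => by
    rw [Real.dist_eq, sub_zero, abs_of_nonneg hs.1]
    exact hs.2.trans_lt hr.2
  -- The second derivative is available at 0 only, so the mean value theorem is combined with the
  -- linear bound on `deriv φ`. This loses the factor 1/2 of Taylor's formula, which is where `2 *
  -- B` in the moment bounds comes from.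
  obtain ⟨c, hc, hc'⟩ := exists_deriv_eq_slope φ hr.1
    (fun s hs => (hball (hin s hs)).1.continuousAt.continuousWithinAt)
    (fun s hs => (hball (hin s (Set.Ioo_subset_Icc_self hs))).1.differentiableWithinAt)
  have hcb := (hball (hin c (Set.Ioo_subset_Icc_self hc))).2
  rw [hc', abs_of_pos hc.1, sub_zero, abs_div, abs_of_pos hr.1, div_le_iff₀ hr.1] at hcb
  calc φ 0 - φ r ≤ |φ r - φ 0| := by rw [abs_sub_comm]; exact le_abs_self _
    _ ≤ (B + η) * c * r := hcb
    _ ≤ (B + η) * r * r := by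
      have := hc.2.le
      have := hr.1.le
      gcongr
    _ = (B + η) * r ^ 2 := by ring

/-- Rewrites the second difference quotient of the cosine in a form that is continuous at `r = 0`,
with value `a ^ 2` there. -/
lemma sq_mul_sinc_sq {r : ℝ} (hr : r ≠ 0) (a : ℝ) :
    a ^ 2 * Real.sinc (r * a / 2) ^ 2 = 2 * (1 - Real.cos (r * a)) / r ^ 2 := by
  by_cases ha : a = 0
  · simp [ha]
  have hcos : Real.cos (r * a) = 1 - 2 * Real.sin (r * a / 2) ^ 2 := by
    rw [← Real.cos_sq_add_sin_sq (r * a / 2), show r * a = 2 * (r * a / 2) by ring, Real.cos_two_mul]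
    ring_nf
    nlinarith [Real.cos_sq_add_sin_sq (r * a * (1 / 2))]
  rw [Real.sinc_of_ne_zero (by positivity), hcos]
  field_simp
  ring

/-- Integrating the second difference quotient of the cosine gives that of `k` along the axis, which
is bounded because `k` has a maximum at 0. Fatou's lemma passes to the limit without prior
integrability of `w i ^ 2`, hence the lower integral. -/
lemma IsSmoothShiftInvariantKernel.lintegral_sq_le (hk : IsSmoothShiftInvariantKernel k B)
    (hp : IsInverseFT p k) (i : Fin d) :
    ∫⁻ w, ENNReal.ofReal (w i ^ 2) ∂p ≤ ENNReal.ofReal (2 * B) := by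
  set φ : ℝ → ℝ := fun r => k (EuclideanSpace.single i r) 0 with hφ
  have hφ0 : φ 0 = 1 := by
    simp only [hφ]
    rw [← hk.one]
    congr 1
    ext j
    simp
  have hmax : IsLocalMax φ 0 := Eventually.of_forall fun r => by
    rw [hφ0]; exact hp.le_one _
  have hint (r : ℝ) : ∫ w : E d, Real.cos (r * w i) ∂p = φ r := by
    simp only [hφ, ← hp.integral_cos, EuclideanSpace.inner_single_right]
    simp
  have hintb (r : ℝ) : Integrable (fun w : E d => Real.cos (r * w i)) p := by
    have := integrable_cos_inner (p := p) (EuclideanSpace.single i r)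
    simpa [EuclideanSpace.inner_single_right] using this
  obtain ⟨h1, h2, h3⟩ := hk.smooth i
  have hB : 0 ≤ B := (abs_nonneg _).trans h3
  set r : ℕ → ℝ := fun n => 1 / ((n : ℝ) + 1) with hr
  have hrpos (n : ℕ) : 0 < r n := by positivity
  have hr0 : Tendsto r atTop (𝓝 0) := tendsto_one_div_add_atTop_nhds_zero_nat
  have hr0' : Tendsto r atTop (𝓝[>] 0) :=
    tendsto_nhdsWithin_iff.2 ⟨hr0, Eventually.of_forall hrpos⟩
  refine ENNReal.le_of_forall_pos_le_add fun η hη _ => ?_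
  have hbound : ∀ᶠ n in atTop,
      ∫⁻ w, ENNReal.ofReal (w i ^ 2 * Real.sinc (r n * w i / 2) ^ 2) ∂p ≤
        ENNReal.ofReal (2 * B) + η := by
    have := hr0'.eventually (eventually_sub_le_of_deriv_deriv h1 h2 h3 hmax
      (show (0 : ℝ) < η / 2 by positivity))
    filter_upwards [this] with n hn
    have e : ∫ w : E d, w i ^ 2 * Real.sinc (r n * w i / 2) ^ 2 ∂p =
        2 * (φ 0 - φ (r n)) / r n ^ 2 := by
      simp only [sq_mul_sinc_sq (hrpos n).ne']
      rw [integral_div, integral_const_mul, integral_sub (integrable_const _) (hintb _), hint, hφ0]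
      simp
    have hi : Integrable (fun w : E d => w i ^ 2 * Real.sinc (r n * w i / 2) ^ 2) p := by
      simp only [sq_mul_sinc_sq (hrpos n).ne']
      exact (((integrable_const _).sub (hintb _)).const_mul _).div_const _
    rw [← ofReal_integral_eq_lintegral_ofReal hi (ae_of_all _ fun w => by positivity), e,
      ← ENNReal.ofReal_coe_nnreal, ← ENNReal.ofReal_add (by positivity) (by positivity)]
    apply ENNReal.ofReal_le_ofReal
    have := hrpos n
    rw [div_le_iff₀ (by positivity)]
    nlinarith [hn]
  have hlim (w : E d) : liminf (fun n =>
      ENNReal.ofReal (w i ^ 2 * Real.sinc (r n * w i / 2) ^ 2)) atTop =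
        ENNReal.ofReal (w i ^ 2) := by
    apply Tendsto.liminf_eq
    have hc : Continuous fun s : ℝ =>
        ENNReal.ofReal (w i ^ 2 * Real.sinc (s * w i / 2) ^ 2) := by
      have := Real.continuous_sinc
      exact ENNReal.continuous_ofReal.comp (by fun_prop)
    have := (hc.tendsto 0).comp hr0
    simpa [Function.comp_def] using this
  calc ∫⁻ w, ENNReal.ofReal (w i ^ 2) ∂p
      = ∫⁻ w, liminf (fun n =>
          ENNReal.ofReal (w i ^ 2 * Real.sinc (r n * w i / 2) ^ 2)) atTop ∂p := by
        simp only [hlim]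
    _ ≤ liminf (fun n =>
          ∫⁻ w, ENNReal.ofReal (w i ^ 2 * Real.sinc (r n * w i / 2) ^ 2) ∂p) atTop := by
        refine lintegral_liminf_le fun n => ?_
        have := Real.continuous_sinc
        exact (by fun_prop : Continuous fun w : E d =>
          w i ^ 2 * Real.sinc (r n * w i / 2) ^ 2).measurable.ennreal_ofReal
    _ ≤ ENNReal.ofReal (2 * B) + η := by
        refine (liminf_le_liminf (u := _) (v := fun _ => ENNReal.ofReal (2 * B) + η) hbound).trans ?_
        simp

lemma IsSmoothShiftInvariantKernel.memLp_coord (hk : IsSmoothShiftInvariantKernel k B)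
    (hp : IsInverseFT p k) (i : Fin d) : MemLp (fun w : E d => w i) 2 p := by
  have hc : Continuous fun w : E d => w i := by fun_prop
  refine (memLp_two_iff_integrable_sq hc.aestronglyMeasurable).2 ⟨?_, ?_⟩
  · exact (hc.pow 2).aestronglyMeasurable
  · rw [hasFiniteIntegral_iff_ofReal (ae_of_all _ fun w => sq_nonneg _)]
    exact (hk.lintegral_sq_le hp i).trans_lt ENNReal.ofReal_lt_top

/-- Nonnegativity of the variance of `|w i|` compares the first moment with the second. -/
lemma IsSmoothShiftInvariantKernel.integral_abs_coord_le (hk : IsSmoothShiftInvariantKernel k B)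
    (hp : IsInverseFT p k) (i : Fin d) :
    ∫ w : E d, |w i| ∂p ≤ √(2 * B) := by
  have hm := hk.memLp_coord hp i
  have hB : 0 ≤ B := (abs_nonneg _).trans (hk.smooth i).2.2
  have hsq : ∫ w : E d, w i ^ 2 ∂p ≤ 2 * B := by
    have h := hk.lintegral_sq_le hp i
    rw [← ofReal_integral_eq_lintegral_ofReal hm.integrable_sq
      (ae_of_all _ fun w => sq_nonneg _)] at h
    exact (ENNReal.ofReal_le_ofReal_iff (by positivity)).1 h
  have hv := variance_nonneg (fun w : E d => |w i|) p
  rw [variance_eq_sub (show MemLp (fun w : E d => |w i|) 2 p from hm.abs)] at hv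
  simp only [Pi.pow_apply, sq_abs] at hv
  exact Real.le_sqrt_of_sq_le (by linarith)

/-- The `1`-norm of a frequency. -/
def freqNorm (w : E d) : ℝ := ∑ i, |w i|

lemma continuous_freqNorm : Continuous (freqNorm (d := d)) := by
  unfold freqNorm; fun_prop

lemma freqNorm_nonneg (w : E d) : 0 ≤ freqNorm w := Finset.sum_nonneg fun _ _ => abs_nonneg _

lemma IsSmoothShiftInvariantKernel.integrable_freqNorm (hk : IsSmoothShiftInvariantKernel k B)
    (hp : IsInverseFT p k) : Integrable (freqNorm (d := d)) p :=
  integrable_finsetSum _ fun i _ => ((hk.memLp_coord hp i).integrable (by norm_num)).abs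

lemma IsSmoothShiftInvariantKernel.integral_freqNorm_le (hk : IsSmoothShiftInvariantKernel k B)
    (hp : IsInverseFT p k) : ∫ w, freqNorm w ∂p ≤ d * √(2 * B) := by
  unfold freqNorm
  rw [integral_finsetSum _ fun i _ => ((hk.memLp_coord hp i).integrable (by norm_num)).abs]
  calc ∑ i : Fin d, ∫ w : E d, |w i| ∂p ≤ ∑ _i : Fin d, √(2 * B) :=
        Finset.sum_le_sum fun i _ => hk.integral_abs_coord_le hp i
    _ = d * √(2 * B) := by simp

/-- The cosine is 1-Lipschitz, and the sup norm is dual to the 1-norm. The sup norm fits a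
coordinatewise grid. -/
lemma abs_cos_inner_sub_le {Δ Δ' : E d} {h : ℝ} (hΔ : ∀ i, |Δ i - Δ' i| ≤ h) (w : E d) :
    |Real.cos (inner ℝ w Δ) - Real.cos (inner ℝ w Δ')| ≤ h * freqNorm w := by
  refine (Real.abs_cos_sub_cos_le _ _).trans ?_
  rw [← inner_sub_right, PiLp.inner_apply, freqNorm, Finset.mul_sum]
  refine (Finset.abs_sum_le_sum_abs _ _).trans (Finset.sum_le_sum fun i _ => ?_)
  simp only [PiLp.sub_apply, RCLike.inner_apply, conj_trivial, abs_mul]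
  exact mul_le_mul_of_nonneg_right (hΔ i) (abs_nonneg _)

lemma IsSmoothShiftInvariantKernel.abs_sub_le (hk : IsSmoothShiftInvariantKernel k B)
    (hp : IsInverseFT p k) {Δ Δ' : E d} {h : ℝ} (h0 : 0 ≤ h) (hΔ : ∀ i, |Δ i - Δ' i| ≤ h) :
    |k Δ 0 - k Δ' 0| ≤ h * (d * √(2 * B)) := by
  rw [← hp.integral_cos, ← hp.integral_cos,
    ← integral_sub (integrable_cos_inner Δ) (integrable_cos_inner Δ')]
  calc |∫ w, (Real.cos (inner ℝ w Δ) - Real.cos (inner ℝ w Δ')) ∂p|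
      ≤ ∫ w, |Real.cos (inner ℝ w Δ) - Real.cos (inner ℝ w Δ')| ∂p := abs_integral_le_integral_abs
    _ ≤ ∫ w, h * freqNorm w ∂p := by
        refine integral_mono ((integrable_cos_inner Δ).sub (integrable_cos_inner Δ')).abs
          ((hk.integrable_freqNorm hp).const_mul h) fun w => abs_cos_inner_sub_le hΔ w
    _ ≤ h * (d * √(2 * B)) := by
        rw [integral_const_mul]
        exact mul_le_mul_of_nonneg_left (hk.integral_freqNorm_le hp) h0

end moments

/-! ## Concentration -/

section concentration
variable {d : ℕ} {p : Measure (E d)} [IsProbabilityMeasure p] {k : E d → E d → ℝ} {B : ℝ}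

lemma integral_eval_iidLaw (f : E d → ℝ) (hf : Continuous f) (j : ℕ) :
    ∫ ω, f (ω j) ∂iidLaw p = ∫ w, f w ∂p := by
  have hmp : MeasurePreserving (fun ω : ℕ → E d => ω j) (iidLaw p) p :=
    measurePreserving_eval_infinitePi (fun _ : ℕ => p) j
  conv_rhs => rw [← hmp.map_eq]
  rw [integral_map hmp.measurable.aemeasurable hf.aestronglyMeasurable]

instance : IsProbabilityMeasure (iidLaw p) := by unfold iidLaw; infer_instance

/-- Hoeffding's inequality for i.i.d. samples. -/
lemma hoeffding_iidLaw {f : E d → ℝ} (hfc : Continuous f) {a : ℝ}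
    (hfa : ∀ w, f w ∈ Set.Icc a (a + 2)) (hf0 : ∫ w, f w ∂p = 0) (m : ℕ) {s : ℝ} (hs : 0 ≤ s) :
    iidLaw p {ω | s ≤ |∑ j ∈ Finset.range m, f (ω j)|} ≤
      ENNReal.ofReal (2 * Real.exp (-s ^ 2 / (2 * m))) := by
  have hind : iIndepFun (fun (j : ℕ) (ω : ℕ → E d) => f (ω j)) (iidLaw p) :=
    iIndepFun_infinitePi (P := fun _ : ℕ => p) (X := fun _ => f) fun _ => hfc.measurable
  -- Hoeffding's lemma: values in an interval of length 2 give sub-Gaussian parameter `(2 / 2)² =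
  -- 1`.
  have hone : (‖a + 2 - a‖₊ / 2) ^ 2 = 1 := by
    rw [add_sub_cancel_left]
    ext
    simp
  have hsub (j : ℕ) : HasSubgaussianMGF (fun ω : ℕ → E d => f (ω j)) 1 (iidLaw p) := by
    have hm : Measurable fun ω : ℕ → E d => f (ω j) :=
      hfc.measurable.comp (measurable_pi_apply j)
    rw [← hone]
    exact hasSubgaussianMGF_of_mem_Icc_of_integral_eq_zero hm.aemeasurable
      (ae_of_all _ fun ω => hfa _) ((integral_eval_iidLaw f hfc j).trans hf0)
  have h1 := HasSubgaussianMGF.measure_sum_range_ge_le_of_iIndepFun hind (c := 1) (n := m)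
    (fun j _ => hsub j) hs
  have h2 := HasSubgaussianMGF.measure_sum_range_ge_le_of_iIndepFun
    (X := fun (j : ℕ) (ω : ℕ → E d) => -f (ω j)) (c := 1) (n := m)
    (hind.comp (fun _ x => -x) fun _ => measurable_neg) (fun j _ => (hsub j).neg) hs
  have hsubset : {ω : ℕ → E d | s ≤ |∑ j ∈ Finset.range m, f (ω j)|} ⊆
      {ω | s ≤ ∑ j ∈ Finset.range m, f (ω j)} ∪ {ω | s ≤ ∑ j ∈ Finset.range m, -f (ω j)} := by
    intro ω hω
    rw [Set.mem_ofPred_eq, le_abs] at hω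
    simpa [Finset.sum_neg_distrib] using hω
  refine (measure_mono hsubset).trans ((measure_union_le _ _).trans ?_)
  rw [two_mul, ENNReal.ofReal_add (Real.exp_pos _).le (Real.exp_pos _).le]
  simp only [NNReal.coe_one, mul_one] at h1 h2
  refine add_le_add ?_ ?_
  · rw [← ofReal_measureReal]; exact ENNReal.ofReal_le_ofReal h1
  · rw [← ofReal_measureReal]; exact ENNReal.ofReal_le_ofReal h2

/-- Hoeffding's inequality for the random features at a point. -/
lemma IsInverseFT.hoeffding (hp : IsInverseFT p k) (Δ : E d) (m : ℕ) {s : ℝ} (hs : 0 ≤ s) :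
    iidLaw p {ω | s ≤ |∑ j ∈ Finset.range m, (Real.cos (inner ℝ (ω j) Δ) - k Δ 0)|} ≤
      ENNReal.ofReal (2 * Real.exp (-s ^ 2 / (2 * m))) := by
  refine hoeffding_iidLaw (f := fun w => Real.cos (inner ℝ w Δ) - k Δ 0) (a := -1 - k Δ 0)
    (by fun_prop) (fun w => ⟨?_, ?_⟩) ?_ m hs
  · exact sub_le_sub_right (Real.neg_one_le_cos _) _
  · linarith [Real.cos_le_one (inner ℝ w Δ)]
  · rw [integral_sub (integrable_cos_inner Δ) (integrable_const _), hp.integral_cos]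
    simp

/-- Markov's inequality for the average `1`-norm of the frequencies. -/
lemma IsSmoothShiftInvariantKernel.markov (hk : IsSmoothShiftInvariantKernel k B)
    (hp : IsInverseFT p k) {m : ℕ} (hm : 1 ≤ m) {h ε δ : ℝ} (h0 : 0 ≤ h) (hε : 0 < ε)
    (hh : h * (d * √(2 * B)) ≤ δ * ε / 8) :
    iidLaw p {ω | ε / 4 ≤ h * ((∑ j ∈ Finset.range m, freqNorm (ω j)) / m)} ≤
      ENNReal.ofReal (δ / 2) := by
  have hm' : (0 : ℝ) < m := by positivity
  have hmp (j : ℕ) : MeasurePreserving (fun ω : ℕ → E d => ω j) (iidLaw p) p :=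
    measurePreserving_eval_infinitePi (fun _ : ℕ => p) j
  have hint (j : ℕ) : Integrable (fun ω : ℕ → E d => freqNorm (ω j)) (iidLaw p) :=
    (hmp j).integrable_comp_of_integrable (hk.integrable_freqNorm hp)
  set X : (ℕ → E d) → ℝ := fun ω => h * ((∑ j ∈ Finset.range m, freqNorm (ω j)) / m) with hX
  have hXi : Integrable X (iidLaw p) :=
    ((integrable_finsetSum _ fun j _ => hint j).div_const _).const_mul _
  have hX0 : 0 ≤ᵐ[iidLaw p] X := ae_of_all _ fun ω =>
    mul_nonneg h0 (div_nonneg (Finset.sum_nonneg fun j _ => freqNorm_nonneg _) hm'.le)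
  have hEX : ∫ ω, X ω ∂iidLaw p ≤ δ * ε / 8 := by
    simp only [hX]
    rw [integral_const_mul, integral_div, integral_finsetSum _ fun j _ => hint j]
    simp only [integral_eval_iidLaw _ continuous_freqNorm]
    rw [Finset.sum_const, Finset.card_range, nsmul_eq_mul, mul_div_cancel_left₀ _ hm'.ne']
    exact (mul_le_mul_of_nonneg_left (hk.integral_freqNorm_le hp) h0).trans hh
  have hmk := mul_meas_ge_le_integral_of_nonneg hX0 hXi (ε / 4)
  rw [← ofReal_measureReal]
  apply ENNReal.ofReal_le_ofReal
  have : ε / 4 * (iidLaw p).real {ω | ε / 4 ≤ X ω} ≤ ε / 4 * (δ / 2) := by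
    refine (hmk.trans hEX).trans (le_of_eq ?_)
    ring
  exact le_of_mul_le_mul_left this (by positivity)

/-- Points of a regular grid with `N` points per dimension in the cube `[-L, L]^d`. -/
def gridPoint (L : ℝ) (N : ℕ) (f : Fin d → Fin N) : E d :=
  WithLp.toLp 2 fun i => -L + (2 * ((f i : ℕ) : ℝ) + 1) * L / N

lemma exists_gridPoint {L : ℝ} {N : ℕ} (hN : 1 ≤ N) (Δ : E d) (hΔ : ∀ i, |Δ i| ≤ L) :
    ∃ f : Fin d → Fin N, ∀ i, |Δ i - gridPoint L N f i| ≤ L / N := by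
  have hN' : (0 : ℝ) < N := by positivity
  have key (a : ℝ) (ha : |a| ≤ L) :
      ∃ j : Fin N, |a - (-L + (2 * ((j : ℕ) : ℝ) + 1) * L / N)| ≤ L / N := by
    obtain ⟨ha1, ha2⟩ := abs_le.1 ha
    -- Grid points are the centres of `N` cells of width `2L / N`. The degenerate cube is separate
    -- because `y` below, the position in units of cells, divides by `2L`.
    rcases eq_or_lt_of_le ((abs_nonneg a).trans ha) with hL | hL
    · refine ⟨⟨0, hN⟩, ?_⟩
      have : a = 0 := by linarith
      simp [← hL, this]
    set y := (a + L) * N / (2 * L) with hy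
    have hy0 : 0 ≤ y := div_nonneg (mul_nonneg (by linarith) hN'.le) (by linarith)
    have hyN : y ≤ N := by
      rw [hy, div_le_iff₀ (by linarith)]
      nlinarith
    have hya : a = -L + y * (2 * L) / N := by
      rw [hy]
      field_simp
      ring
    obtain ⟨j, hj1, hj2⟩ : ∃ j : Fin N, ((j : ℕ) : ℝ) ≤ y ∧ y ≤ (j : ℕ) + 1 := by
      rcases lt_or_ge y N with h | h
      · exact ⟨⟨⌊y⌋₊, (Nat.floor_lt hy0).2 h⟩, Nat.floor_le hy0, (Nat.lt_floor_add_one y).le⟩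
      -- The right end point `y = N` is assigned to the last cell.
      · refine ⟨⟨N - 1, by omega⟩, ?_, ?_⟩
        · simp only [Nat.cast_sub hN, Nat.cast_one]; linarith
        · simp only [Nat.cast_sub hN, Nat.cast_one]; linarith
    refine ⟨j, ?_⟩
    have e : a - (-L + (2 * ((j : ℕ) : ℝ) + 1) * L / N) = (2 * y - 2 * (j : ℕ) - 1) * (L / N) := by
      rw [hya]; ring
    rw [e, abs_mul, abs_of_pos (show 0 < L / N by positivity)]
    refine mul_le_of_le_one_left (by positivity) (abs_le.2 ⟨?_, ?_⟩) <;> linarith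
  choose f hf using fun i => key (Δ i) (hΔ i)
  exact ⟨f, hf⟩

/-- Uniform convergence of random Fourier features, in terms of the size of a grid. -/
lemma IsSmoothShiftInvariantKernel.uniform_bound (hk : IsSmoothShiftInvariantKernel k B)
    (hp : IsInverseFT p k) {R ε δ : ℝ} {m N : ℕ} (hm : 1 ≤ m) (hN : 1 ≤ N) (hR : 0 ≤ R)
    (hε : 0 < ε) (hδ : 0 < δ) (hδ1 : δ < 1)
    (hN1 : 2 * R / N * (d * √(2 * B)) ≤ δ * ε / 8)
    (hN2 : (N : ℝ) ^ d * (2 * Real.exp (-(m * ε ^ 2 / 8))) ≤ δ / 2) {𝒳 : Set (E d)}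
    (h𝒳 : ∀ x ∈ 𝒳, ∀ i, |x i| ≤ R) :
    iidLaw p {ω | ∃ x ∈ 𝒳, ∃ x' ∈ 𝒳,
      ε ≤ |∑ i, rffMap m ω x i * rffMap m ω x' i - k x x'|} ≤ ENNReal.ofReal δ := by
  have hm' : (0 : ℝ) < m := by positivity
  set h := 2 * R / N with hh
  have h0 : 0 ≤ h := by positivity
  -- The grid covers differences `x - x'`, hence the radius `2R` and the mesh bound `h = 2R / N`.
  set G := gridPoint (d := d) (2 * R) N with hG
  have hsubset : {ω : ℕ → E d | ∃ x ∈ 𝒳, ∃ x' ∈ 𝒳,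
      ε ≤ |∑ i, rffMap m ω x i * rffMap m ω x' i - k x x'|} ⊆
      {ω | ε / 4 ≤ h * ((∑ j ∈ Finset.range m, freqNorm (ω j)) / m)} ∪
        ⋃ f : Fin d → Fin N, {ω | m * ε / 2 ≤
          |∑ j ∈ Finset.range m, (Real.cos (inner ℝ (ω j) (G f)) - k (G f) 0)|} := by
    rintro ω ⟨x, hx, x', hx', hεω⟩
    by_contra hcon
    simp only [Set.mem_union, Set.mem_ofPred_eq, Set.mem_iUnion, not_or, not_exists, not_le] at hcon
    obtain ⟨hc1, hc2⟩ := hcon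
    set Δ := x - x' with hΔdef
    have hΔ : ∀ i, |Δ i| ≤ 2 * R := fun i => by
      have := abs_sub (x i) (x' i)
      have h1 := h𝒳 x hx i
      have h2 := h𝒳 x' hx' i
      simp only [hΔdef, PiLp.sub_apply]
      linarith
    obtain ⟨f, hf⟩ := exists_gridPoint hN Δ hΔ
    have hkΔ : k x x' = k Δ 0 := by
      have := hk.shift x x' (-x')
      rw [← this, add_neg_cancel, hΔdef, sub_eq_add_neg]
    rw [sum_rffMap_mul_rffMap ω x x' hm, hkΔ, ← hΔdef] at hεω
    have b1 : |k (G f) 0 - k Δ 0| ≤ δ * ε / 8 := by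
      rw [abs_sub_comm]
      exact (hk.abs_sub_le hp h0 hf).trans hN1
    have b2 : |(∑ j ∈ Finset.range m, Real.cos (inner ℝ (ω j) (G f))) / m - k (G f) 0| < ε / 2 := by
      have h2 := hc2 f
      rw [Finset.sum_sub_distrib, Finset.sum_const, Finset.card_range, nsmul_eq_mul] at h2
      rw [show (∑ j ∈ Finset.range m, Real.cos (inner ℝ (ω j) (G f))) / m - k (G f) 0 =
        (∑ j ∈ Finset.range m, Real.cos (inner ℝ (ω j) (G f)) - m * k (G f) 0) / m by field_simp,
        abs_div, abs_of_pos hm', div_lt_iff₀ hm']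
      linarith
    have b3 : |(∑ j ∈ Finset.range m, Real.cos (inner ℝ (ω j) Δ)) / m -
        (∑ j ∈ Finset.range m, Real.cos (inner ℝ (ω j) (G f))) / m| < ε / 4 := by
      refine lt_of_le_of_lt ?_ hc1
      rw [← sub_div, ← Finset.sum_sub_distrib, abs_div, abs_of_pos hm', mul_div_assoc',
        Finset.mul_sum]
      refine div_le_div_of_nonneg_right ?_ hm'.le
      exact (Finset.abs_sum_le_sum_abs _ _).trans
        (Finset.sum_le_sum fun j _ => abs_cos_inner_sub_le hf _)
    have b4 := _root_.abs_sub_le ((∑ j ∈ Finset.range m, Real.cos (inner ℝ (ω j) Δ)) / m)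
      ((∑ j ∈ Finset.range m, Real.cos (inner ℝ (ω j) (G f))) / m) (k Δ 0)
    have b5 := _root_.abs_sub_le ((∑ j ∈ Finset.range m, Real.cos (inner ℝ (ω j) (G f))) / m)
      (k (G f) 0) (k Δ 0)
    have b6 : δ * ε ≤ ε := by nlinarith
    -- Error budget: below `ε/4` for moving the average to the grid, below `ε/2` at the grid point,
    -- and at most `δε/8 ≤ ε/8` for moving the kernel back.
    linarith
  have hun : iidLaw p (⋃ f : Fin d → Fin N, {ω | m * ε / 2 ≤
      |∑ j ∈ Finset.range m, (Real.cos (inner ℝ (ω j) (G f)) - k (G f) 0)|}) ≤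
        ENNReal.ofReal (δ / 2) := by
    refine (measure_iUnion_fintype_le _ _).trans ?_
    refine (Finset.sum_le_sum fun f _ =>
      hp.hoeffding (G f) m (s := m * ε / 2) (by positivity)).trans ?_
    rw [Finset.sum_const, Finset.card_univ, Fintype.card_fun, Fintype.card_fin, Fintype.card_fin,
      nsmul_eq_mul, ← ENNReal.ofReal_natCast, ← ENNReal.ofReal_mul (by positivity)]
    apply ENNReal.ofReal_le_ofReal
    refine le_trans (le_of_eq ?_) hN2
    rw [Nat.cast_pow, show -(m * ε / 2) ^ 2 / (2 * m) = -(m * ε ^ 2 / 8) by field_simp; ring]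
  refine (measure_mono hsubset).trans ((measure_union_le _ _).trans ?_)
  rw [← add_halves δ, ENNReal.ofReal_add (by positivity) (by positivity)]
  exact add_le_add (hk.markov hp hm h0 hε hN1) hun

end concentration

/-! ## The number of features -/

/-- The constant in the number of features. -/
def featureConst (δ : ℝ) : ℝ := 8 * (Real.log (4 / δ) + Real.log (2 + 32 / δ) + 1)

lemma featureConst_pos {δ : ℝ} (h0 : 0 < δ) (h1 : δ < 1) : 0 < featureConst δ := by
  have e1 : 0 ≤ Real.log (4 / δ) := Real.log_nonneg (by rw [le_div_iff₀ h0]; linarith)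
  have e2 : 0 ≤ Real.log (2 + 32 / δ) := Real.log_nonneg (by
    have := div_pos (by norm_num : (0 : ℝ) < 32) h0
    linarith)
  unfold featureConst
  positivity

lemma one_le_halfDim {C R B ε : ℝ} {d : ℕ} (hC : 0 < C) (hd : 1 ≤ d) (hε : 0 < ε) :
    1 ≤ halfDim C R B ε d := by
  have : (0 : ℝ) < d := by positivity
  have h := Real.posLog_nonneg (x := R * d * √B / ε)
  exact Nat.one_le_ceil_iff.2 (by positivity)

lemma exists_grid_size {R B ε δ : ℝ} {d : ℕ} (h0 : 0 < δ) (h1 : δ < 1) (hd : 1 ≤ d) (hε : 0 < ε)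
    (hR : 0 ≤ R) : ∃ N : ℕ, 1 ≤ N ∧ 2 * R / N * (d * √(2 * B)) ≤ δ * ε / 8 ∧
      (N : ℝ) ^ d * (2 * Real.exp (-(halfDim (featureConst δ) R B ε d * ε ^ 2 / 8))) ≤ δ / 2 := by
  set y := R * d * √B / ε with hy
  have hy0 : 0 ≤ y := by positivity
  have hd' : (1 : ℝ) ≤ d := by exact_mod_cast hd
  -- The Lipschitz condition amounts to `4yε / N ≤ δε / 8`, that is `N ≥ 32y / δ`; the extra 1 keeps
  -- `N` positive when `y = 0`.
  set N := ⌈32 * y / δ⌉₊ + 1 with hN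
  have hN0 : (0 : ℝ) < N := by positivity
  have hNy : 32 * y / δ ≤ N := by
    rw [hN]; push_cast
    linarith [Nat.le_ceil (32 * y / δ)]
  have hlogN : Real.log N ≤ Real.log (2 + 32 / δ) + Real.posLog y := by
    have hmax : (N : ℝ) ≤ (2 + 32 / δ) * max 1 y := by
      have e1 : (N : ℝ) ≤ 32 * y / δ + 2 := by
        rw [hN]; push_cast
        linarith [(Nat.ceil_lt_add_one (show 0 ≤ 32 * y / δ by positivity)).le]
      have e2 : 32 * y / δ ≤ 32 / δ * max 1 y := by
        rw [mul_div_right_comm]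
        exact mul_le_mul_of_nonneg_left (le_max_right _ _) (by positivity)
      have e3 : (1 : ℝ) ≤ max 1 y := le_max_left _ _
      nlinarith
    have hmx : 0 < max 1 y := lt_of_lt_of_le one_pos (le_max_left _ _)
    rw [Real.posLog_eq_log_max_one hy0, ← Real.log_mul (by positivity) hmx.ne']
    exact Real.log_le_log hN0 hmax
  refine ⟨N, by omega, ?_, ?_⟩
  · have e1 : √(2 * B) ≤ 2 * √B := by
      rw [Real.sqrt_mul (by norm_num)]
      have : √2 ≤ 2 := by rw [Real.sqrt_le_left (by norm_num)]; norm_num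
      gcongr
    have e2 : R * d * √B = y * ε := by rw [hy]; field_simp
    have e3 : 32 * y ≤ N * δ := by rwa [div_le_iff₀ h0] at hNy
    calc 2 * R / N * (d * √(2 * B)) ≤ 2 * R / N * (d * (2 * √B)) := by gcongr
      _ = 4 * (R * d * √B) / N := by ring
      _ = 4 * (y * ε) / N := by rw [e2]
      _ ≤ δ * ε / 8 := by
        rw [div_le_iff₀ hN0]
        nlinarith
  · set m := halfDim (featureConst δ) R B ε d with hm
    have e1 : 0 ≤ Real.log (4 / δ) := Real.log_nonneg (by rw [le_div_iff₀ h0]; linarith)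
    have e2 : 0 ≤ Real.log (2 + 32 / δ) := Real.log_nonneg (by
      have := div_pos (by norm_num : (0 : ℝ) < 32) h0
      linarith)
    have e3 : 0 ≤ Real.posLog y := Real.posLog_nonneg
    have hmle : featureConst δ * (d / ε ^ 2) * (1 + Real.posLog y) ≤ m := Nat.le_ceil _
    -- This is the logarithm of the union bound `N^d · 2 exp(-mε²/8) ≤ δ/2`. The factor 8 in
    -- `featureConst` cancels Hoeffding's 1/8.
    have hmε : Real.log (4 / δ) + d * Real.log N ≤ m * ε ^ 2 / 8 := by
      have f1 : featureConst δ * (d / ε ^ 2) * (1 + Real.posLog y) * ε ^ 2 / 8 =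
          d * (Real.log (4 / δ) + Real.log (2 + 32 / δ) + 1) * (1 + Real.posLog y) := by
        unfold featureConst
        field_simp
      have f2 : d * (Real.log (4 / δ) + Real.log (2 + 32 / δ) + 1) * (1 + Real.posLog y) ≤
          m * ε ^ 2 / 8 := by
        rw [← f1]
        gcongr
      refine le_trans ?_ f2
      have f3 : d * Real.log N ≤ d * (Real.log (2 + 32 / δ) + Real.posLog y) := by gcongr
      have f4 : Real.log (4 / δ) ≤ d * Real.log (4 / δ) := le_mul_of_one_le_left e1 hd'
      have f5 : 0 ≤ d * ((Real.log (4 / δ) + Real.log (2 + 32 / δ)) * Real.posLog y + 1) := by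
        positivity
      nlinarith
    have hexp : Real.exp (-(m * ε ^ 2 / 8)) ≤ (4 / δ)⁻¹ * ((N : ℝ) ^ d)⁻¹ := by
      calc Real.exp (-(m * ε ^ 2 / 8)) ≤ Real.exp (-(Real.log (4 / δ) + d * Real.log N)) :=
            Real.exp_le_exp.2 (neg_le_neg hmε)
        _ = (4 / δ)⁻¹ * ((N : ℝ) ^ d)⁻¹ := by
          rw [Real.exp_neg, Real.exp_add, Real.exp_log (by positivity), Real.exp_nat_mul,
            Real.exp_log hN0, mul_inv]
    calc (N : ℝ) ^ d * (2 * Real.exp (-(m * ε ^ 2 / 8)))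
        ≤ (N : ℝ) ^ d * (2 * ((4 / δ)⁻¹ * ((N : ℝ) ^ d)⁻¹)) := by gcongr
      _ = δ / 2 := by
        field_simp
        norm_num

/-- Uniform convergence of random Fourier features. -/
lemma IsSmoothShiftInvariantKernel.rff_error {d : ℕ} {p : Measure (E d)} [IsProbabilityMeasure p]
    {k : E d → E d → ℝ} {R B ε δ : ℝ} (hk : IsSmoothShiftInvariantKernel k B)
    (hp : IsInverseFT p k) (h0 : 0 < δ) (h1 : δ < 1) (hd : 1 ≤ d) (hε : 0 < ε) {𝒳 : Set (E d)}
    (h𝒳 : ∀ x ∈ 𝒳, ∀ i, |x i| ≤ R) :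
    iidLaw p {ω | ∃ x ∈ 𝒳, ∃ x' ∈ 𝒳,
      ε ≤ |∑ i, rffMap (halfDim (featureConst δ) R B ε d) ω x i *
        rffMap (halfDim (featureConst δ) R B ε d) ω x' i - k x x'|} ≤ ENNReal.ofReal δ := by
  rcases 𝒳.eq_empty_or_nonempty with rfl | ⟨x, hx⟩
  · simp
  -- A point of the data set, together with `1 ≤ d`, forces `R` to be nonnegative.
  · have hR : 0 ≤ R := (abs_nonneg _).trans (h𝒳 x hx ⟨0, hd⟩)
    obtain ⟨N, hN, hN1, hN2⟩ := exists_grid_size h0 h1 hd hε hR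
    exact hk.uniform_bound hp (one_le_halfDim (featureConst_pos h0 h1) hd hε) hN hR hε h0 h1 hN1
      hN2 h𝒳
/-! ## Running time -/

section runtime
variable {d : ℕ} (env : Env d) (m : ℕ) (x : E d)

/-- By minimality of `n`, `4 ^ n` exceeds `D` by a factor of at most 4. Estimating `2 ^ n` by `4 ^
n` is crude, but it keeps the enumeration of eigenvectors polynomial. -/
lemma two_pow_numQubits_le (m : ℕ) : 2 ^ numQubits (2 * m) ≤ 8 * (m + 1) := by
  rcases Nat.eq_zero_or_pos m with rfl | hm
  · simp [numQubits]
  have h1 : 4 ^ (Nat.clog 4 (2 * m + 1)).pred < 2 * m + 1 :=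
    Nat.pow_pred_clog_lt_self (by norm_num) (by omega)
  have h2 : 0 < Nat.clog 4 (2 * m + 1) := Nat.clog_pos (by norm_num) (by omega)
  have h3 : 4 ^ numQubits (2 * m) = 4 * 4 ^ (Nat.clog 4 (2 * m + 1)).pred := by
    rw [numQubits, ← pow_succ']
    exact congrArg _ (Nat.succ_pred_eq_of_pos h2).symm
  have h4 : 2 ^ numQubits (2 * m) ≤ 4 ^ numQubits (2 * m) := Nat.pow_le_pow_left (by norm_num) _
  omega

lemma time_loadedState_le :
    ((buildState storeSamples m env).storeVec 0 0 x).time ≤ 2 + m * (env.t + d + 7) := by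
  refine (exec_time_le env (R := [1]) (by decide) (startState d m)).trans (le_of_eq ?_)
  simp only [Prog.cost, storeSamples, startState, NExp.size, NExp.eval]
  simp only [one_ne_zero, if_false, if_true]
  ring

lemma time_computeFeatures_le :
    (finalState storeSamples computeFeatures m env x).time ≤
      100 * ((m + 1) ^ 3 * (env.t + d + 1)) := by
  obtain ⟨h0, h1, -⟩ := loadedState_spec env m x
  refine (exec_time_le env (R := [0, 1]) (by decide) _).trans
    ((Nat.add_le_add_right (time_loadedState_le env m x) _).trans ?_)
  simp [Prog.cost, computeFeatures, featurePair, innerProd, innerStep, scaleExp, NExp.size,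
    RExp.size, NExp.eval, h0, h1]
  ring_nf
  omega

lemma cost_prepareEigenvector_le {s : State} (h1 : s.reg 1 = m)
    (h5 : s.reg 5 = numQubits (2 * m)) (h7 : s.reg 7 = 2 ^ numQubits (2 * m)) (t : ℕ) :
    prepareEigenvector.cost t d s ≤ 3000 * (m + 1) ^ 3 := by
  have hn := numQubits_le m
  have hq := two_pow_numQubits_le m
  simp [Prog.cost, prepareEigenvector, chooseOutcome, applyGates, pauliStep, outcomeStep,
    computeSign, signStep, qubitStep, dimExp, weightExp, absExp, NExp.mod2, NExp.mod4, NExp.div4,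
    NExp.size, RExp.size, Test.size, NExp.eval, h1, h5, h7]
  generalize numQubits (2 * m) = n at *
  generalize 2 ^ n = q at *
  -- The exact cost with `n` replaced by `2m` and `2 ^ n` by `8(m + 1)`, so that a comparison of
  -- polynomials in `m` remains.
  refine le_trans (b := 2 + (3 + (2 + (4 + (m + m) * (1 + (2 + (2 + 8 * (m + 1) * (1 + (3 + (4 + (2 +
    (2 + 2 * m * 45))) + 40)) + 4))))) + (2 + (2 + (2 + (2 + 2 * m * 92))) + 4))) (by gcongr) ?_
  ring_nf
  omega

/-- The loop bounds of `prepareEigenvector` sit in registers 5 and 7, which `allocQubits` writes.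
Hence `exec_time_le` is applied stage by stage, with the register values known at the start of each
stage. -/
lemma time_prepareState_le :
    (finalState storeSamples prepareState m env x).time ≤
      10000 * ((m + 1) ^ 3 * (env.t + d + 1)) := by
  set s₀ := (buildState storeSamples m env).storeVec 0 0 x with hs₀
  obtain ⟨h0, h1, -, -, hq, -⟩ := loadedState_spec env m x
  rw [← hs₀] at h0 h1 hq
  set s₁ := exec env computeFeatures s₀ with hs₁
  set s₂ := exec env computeNorm s₁ with hs₂
  set s₃ := exec env allocQubits s₂ with hs₃
  have r1 : s₁.reg 1 = m := (exec_reg env (by decide) _).trans h1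
  have r2 : s₂.reg 1 = m := (exec_reg env (by decide) _).trans r1
  have r3 : s₃.reg 1 = m := (exec_reg env (by decide) _).trans r2
  have q2 : s₂.nqubit = 0 := by
    rw [hs₂, exec_nqubit env (by decide), hs₁, exec_nqubit env (by decide), hq]
  obtain ⟨-, a2, a3⟩ := exec_allocQubits env r2 q2
  rw [← hs₃] at a2 a3
  have t1 : s₁.time ≤ 100 * ((m + 1) ^ 3 * (env.t + d + 1)) := time_computeFeatures_le env m x
  have t2 := exec_time_le env (c := computeNorm) (R := [1]) (by decide) s₁
  have t3 := exec_time_le env (c := allocQubits) (R := [1]) (by decide) s₂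
  have t4 := exec_time_le env (c := prepareEigenvector) (R := [1, 5, 7]) (by decide) s₃
  have c2 : computeNorm.cost env.t d s₁ ≤ 100 * (m + 1) := by
    simp [Prog.cost, computeNorm, normStep, dimExp, absExp, NExp.size, RExp.size, NExp.eval, r1]
    omega
  have c3 : allocQubits.cost env.t d s₂ ≤ 200 * (m + 1) := by
    simp [Prog.cost, allocQubits, allocStep, dimExp, NExp.size, Test.size, NExp.eval, r2]
    omega
  have c4 := cost_prepareEigenvector_le (d := d) m r3 a2 a3 env.t
  have hfin : finalState storeSamples prepareState m env x = exec env prepareEigenvector s₃ := rfl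
  rw [hfin]
  have hle : (m + 1) ^ 3 ≤ (m + 1) ^ 3 * (env.t + d + 1) := Nat.le_mul_of_pos_right _ (by omega)
  have hle' : m + 1 ≤ (m + 1) ^ 3 := Nat.le_self_pow (by norm_num) _
  rw [← hs₂] at t2
  rw [← hs₃] at t3
  omega

end runtime

/-! ### A polynomial bound in `d + ⌈1/ε⌉`. -/

lemma posLog_le_abs (y : ℝ) : Real.posLog y ≤ |y| := by
  refine max_le (abs_nonneg y) ?_
  rw [← Real.log_abs]
  exact Real.log_le_self (abs_nonneg y)

/-- The positive logarithm is estimated by the absolute value of its argument, `1/ε` by its ceiling,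
and both `d` and that ceiling by their sum. All constants are rounded up so that the bound is a
polynomial over `ℕ`; `|R|` appears because the sign of `R` is arbitrary here. -/
lemma halfDim_le (C R B : ℝ) {ε : ℝ} (d : ℕ) (hε : 0 < ε) :
    halfDim C R B ε d ≤
      ⌈C⌉₊ * (d + ⌈1 / ε⌉₊) ^ 3 * (1 + ⌈|R| * √B⌉₊ * (d + ⌈1 / ε⌉₊) ^ 2) := by
  refine Nat.ceil_le.2 ?_
  push_cast
  have h1 : C ≤ ⌈C⌉₊ := Nat.le_ceil C
  have h2 : 1 / ε ≤ ⌈1 / ε⌉₊ := Nat.le_ceil _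
  have h3 : |R| * √B ≤ ⌈|R| * √B⌉₊ := Nat.le_ceil _
  have h4 : (0 : ℝ) ≤ d := d.cast_nonneg
  have h5 : 0 < 1 / ε := by positivity
  have hc : (0 : ℝ) ≤ ⌈C⌉₊ := Nat.cast_nonneg _
  have he : (0 : ℝ) ≤ ⌈1 / ε⌉₊ := Nat.cast_nonneg _
  have ha : (0 : ℝ) ≤ ⌈|R| * √B⌉₊ := Nat.cast_nonneg _
  generalize (⌈C⌉₊ : ℝ) = c at *
  generalize (⌈1 / ε⌉₊ : ℝ) = e at *
  generalize (⌈|R| * √B⌉₊ : ℝ) = a at *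
  have h6 : Real.posLog (R * d * √B / ε) ≤ a * (d + e) ^ 2 := by
    refine (posLog_le_abs _).trans ?_
    rw [abs_div, abs_mul, abs_mul, abs_of_pos hε, abs_of_nonneg (Real.sqrt_nonneg B),
      abs_of_nonneg h4]
    calc |R| * d * √B / ε = |R| * √B * (d * (1 / ε)) := by ring
      _ ≤ a * ((d + e) * (d + e)) := by
        gcongr <;> linarith
      _ = a * (d + e) ^ 2 := by ring
  have h7 : (d : ℝ) / ε ^ 2 ≤ (d + e) ^ 3 := by
    calc (d : ℝ) / ε ^ 2 = d * (1 / ε) * (1 / ε) := by field_simp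
      _ ≤ (d + e) * (d + e) * (d + e) := by
        gcongr <;> first | positivity | linarith
      _ = (d + e) ^ 3 := by ring
  have h8 : 0 ≤ Real.posLog (R * d * √B / ε) := Real.posLog_nonneg
  have h9 : 0 ≤ (d : ℝ) / ε ^ 2 := by positivity
  gcongr

lemma eval_mono_of_nat (T : Polynomial ℕ) {a b : ℕ} (h : a ≤ b) : T.eval a ≤ T.eval b := by
  rw [Polynomial.eval_eq_sum_range, Polynomial.eval_eq_sum_range]
  gcongr

/-- The running times are polynomial. -/
lemma exists_time_polynomial (C R B : ℝ) {t : ℕ → ℕ} {T : Polynomial ℕ}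
    (hT : ∀ d, 1 ≤ d → t d ≤ T.eval d) :
    ∃ P : Polynomial ℕ, ∀ (d : ℕ) (ε : ℝ), 1 ≤ d → 0 < ε →
      ∀ (ω : ℕ → E d) (u : ℕ → unitInterval) (x : E d),
        (finalState storeSamples computeFeatures (halfDim C R B ε d) ⟨t d, ω, u⟩ x).time
          ≤ P.eval (d + ⌈1 / ε⌉₊) ∧
        (finalState storeSamples prepareState (halfDim C R B ε d) ⟨t d, ω, u⟩ x).time
          ≤ P.eval (d + ⌈1 / ε⌉₊) := by
  set M : Polynomial ℕ := .C ⌈C⌉₊ * .X ^ 3 * (1 + .C ⌈|R| * √B⌉₊ * .X ^ 2) with hM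
  refine ⟨.C 10000 * ((M + 1) ^ 3 * (T + .X + 1)), fun d ε hd hε ω u x => ?_⟩
  have hm := halfDim_le C R B d hε
  have ht : t d ≤ T.eval (d + ⌈1 / ε⌉₊) :=
    (hT d hd).trans (eval_mono_of_nat T (Nat.le_add_right _ _))
  have e : (.C 10000 * ((M + 1) ^ 3 * (T + .X + 1)) : Polynomial ℕ).eval (d + ⌈1 / ε⌉₊) =
      10000 * ((⌈C⌉₊ * (d + ⌈1 / ε⌉₊) ^ 3 * (1 + ⌈|R| * √B⌉₊ * (d + ⌈1 / ε⌉₊) ^ 2) + 1) ^ 3 *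
        (T.eval (d + ⌈1 / ε⌉₊) + (d + ⌈1 / ε⌉₊) + 1)) := by
    simp [hM]
  have hbound : 10000 * ((halfDim C R B ε d + 1) ^ 3 * (t d + d + 1)) ≤
      (.C 10000 * ((M + 1) ^ 3 * (T + .X + 1)) : Polynomial ℕ).eval (d + ⌈1 / ε⌉₊) := by
    rw [e]
    gcongr
    exact Nat.le_add_right _ _
  refine ⟨(time_computeFeatures_le _ _ x).trans (le_trans ?_ hbound),
    (time_prepareState_le _ _ x).trans hbound⟩
  gcongr
  norm_num

end QRFF

end

/-! ### The theorem. -/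

open QRFF
theorem corollary2 :
    ∃ build evaluate prepare : Prog,
      ImplementsRFF build evaluate ∧ ImplementsQRFF build prepare ∧
      ∀ δ : ℝ, 0 < δ → δ < 1 → ∃ C : ℝ, 0 < C ∧
        ∀ (R B : ℝ) (t : ℕ → ℕ),
          (∃ T : Polynomial ℕ, ∀ d, 1 ≤ d → t d ≤ T.eval d) →
          ∃ P : Polynomial ℕ, ∀ (d : ℕ) (ε : ℝ), 1 ≤ d → 0 < ε →
            -- the total run-times, for every outcome of the random choices
            (∀ (ω : ℕ → E d) (u : ℕ → unitInterval) (x : E d),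
              (finalState build evaluate (halfDim C R B ε d) ⟨t d, ω, u⟩ x).time
                ≤ P.eval (d + ⌈1 / ε⌉₊) ∧
              (finalState build prepare (halfDim C R B ε d) ⟨t d, ω, u⟩ x).time
                ≤ P.eval (d + ⌈1 / ε⌉₊)) ∧
            -- the outputs are approximations of the kernel
            ∀ (𝒳 : Set (E d)) (k : E d → E d → ℝ) (p : Measure (E d)) [IsProbabilityMeasure p],
              IsCompact 𝒳 → (∀ x ∈ 𝒳, ∀ i, |x i| ≤ R) →
              IsSmoothShiftInvariantKernel k B → IsInverseFT p k →
              iidLaw p {ω | ∃ x ∈ 𝒳, ∃ x' ∈ 𝒳,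
                ε ≤ |∑ i, rffMap (halfDim C R B ε d) ω x i * rffMap (halfDim C R B ε d) ω x' i
                      - k x x'|} ≤ ENNReal.ofReal δ ∧
              (∀ (ω : ℕ → E d) (x : E d), IsDensity (qrffState (halfDim C R B ε d) ω x)) ∧
              iidLaw p {ω | ∃ x ∈ 𝒳, ∃ x' ∈ 𝒳,
                ε ≤ ‖(rffNorm (halfDim C R B ε d) ω x * rffNorm (halfDim C R B ε d) ω x' : ℂ) *
                      (2 ^ numQubits (2 * halfDim C R B ε d) *
                        eqk (qrffState (halfDim C R B ε d) ω) x x' - 1)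
                      - k x x'‖} ≤ ENNReal.ofReal δ := by
  refine ⟨storeSamples, computeFeatures, prepareState, implementsRFF, implementsQRFF,
    fun δ h0 h1 => ⟨featureConst δ, featureConst_pos h0 h1, fun R B t ⟨T, hT⟩ => ?_⟩⟩
  obtain ⟨P, hP⟩ := exists_time_polynomial (featureConst δ) R B hT
  refine ⟨P, fun d ε hd hε => ⟨hP d ε hd hε, fun 𝒳 k p _ _ h𝒳 hk hp => ?_⟩⟩
  have hm : 1 ≤ halfDim (featureConst δ) R B ε d :=
    one_le_halfDim (featureConst_pos h0 h1) hd hε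
  have hrff := hk.rff_error hp h0 h1 hd hε h𝒳
  refine ⟨hrff, fun ω x => isDensity_qrffState ω x hm, ?_⟩
  -- The corrected quantum kernel is the classical one for every `ω`, so both failure events are the
  -- same set.
  simp only [eqk_qrffState _ _ _ hm, ← Complex.ofReal_sub, Complex.norm_real, Real.norm_eq_abs]
  exact hrff
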